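/- Let $\Lambda$ be a nonzero artin algebra, that is, a nonzero algebra that is finitely generated as a module over a commutative artinian ring $k$, and let $\operatorname{mod}\Lambda$ be the category of finitely generated right $\Lambda$-modules. Let $\mathcal S$ be a set of simple $\Lambda$-modules of finite projective dimension. Then $$\dim \operatorname{mod}\Lambda \;\le\; \operatorname{pd}\mathcal S+\ell\ell^{t_{\mathcal S}}(\Lambda).$$ Here the notation is as follows. * For a class $\mathcal U$ of objects of an abelian category $\mathcal A$, $\operatorname{add}\mathcal U$ is the class of direct summands of finite direct sums of objects of $\mathcal U$. For classes $\mathcal U_1,\mathcal U_2$, $\mathcal U_1\diamond\mathcal U_2$ is $\operatorname{add}$ of the class of all $A$ admitting a short exact sequence $0\to U_1\to A\to U_2\to 0$ with $U_i\in\mathcal U_i$. For an object $T$, put $\langle T\rangle_1=\operatorname{add}\{T\}$ and $\langle T\rangle_{n}=\langle T\rangle_1\diamond\langle T\rangle_{n-1}$ for $n\ge 2$. The extension dimension is $\dim\mathcal A=\inf\{n\ge 0\mid \mathcal A=\langle T\rangle_{n+1}\text{ for some }T\in\mathcal A\}$ (and $+\infty$ if there is no such $n$). * $\operatorname{pd}\mathcal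 S=\sup\{\operatorname{pd}M\mid M\in\mathcal S\}$ if $\mathcal S\neq\emptyset$, and $\operatorname{pd}\emptyset=-1$. * $\mathcal T_{\mathcal S}$ is the class of $M\in\operatorname{mod}\Lambda$ with $M/\operatorname{rad}M\in\operatorname{add}\mathcal S'$, where $\mathcal S'$ is the class of simple $\Lambda$-modules not isomorphic to a module in $\mathcal S$, and $\operatorname{rad} M$ is the intersection of the maximal submodules of $M$. The functor $t_{\mathcal S}$ is the trace of $\mathcal T_{\mathcal S}$: $t_{\mathcal S}(M)=\sum\{\operatorname{Im}f\mid f\in\operatorname{Hom}_\Lambda(T,M),\ T\in\mathcal T_{\mathcal S}\}$. * With $F=\operatorname{rad}\circ\, t_{\mathcal S}$, the $t_{\mathcal S}$-radical layer length of $M$ is $\ell\ell^{t_{\mathcal S}}(M)=\inf\{i\ge 0\mid t_{\mathcal S}(F^{i}(M))=0\}$; it is applied to $\Lambda$ as a right module over itself. -/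

import Mathlib

open CategoryTheory CategoryTheory.Limits
open scoped ENNReal

universe w v u

namespace ExtDim

noncomputable section

section Category

/- The notions of this section are meant for an abelian category `C`; only the zero morphisms of `C`
are needed to write them down. Classes of objects are `ObjectProperty`s. -/

variable {C : Type u} [Category.{v} C] [HasZeroMorphisms C]

/-- `add U`: the direct summands of finite (possibly empty) direct sums of objects of `U`. -/
def add (U : ObjectProperty C) : ObjectProperty C := fun X =>
  ∃ (n : ℕ) (f : Fin n → C) (b : Bicone f),
    (∀ i, U (f i)) ∧ Nonempty b.IsBilimit ∧ Nonempty (Retract X b.pt)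

/-- `U₁ ⋄ U₂`: `add` of the class of the middle terms `A` of short exact sequences
`0 ⟶ X₁ ⟶ A ⟶ X₂ ⟶ 0` with `X₁` in `U₁` and `X₂` in `U₂`. -/
def diamond (U₁ U₂ : ObjectProperty C) : ObjectProperty C :=
  add fun A => ∃ S : ShortComplex C, S.ShortExact ∧ S.X₂ = A ∧ U₁ S.X₁ ∧ U₂ S.X₃

/-- `⟨U⟩ₙ`: `⟨U⟩₀ = 0`, `⟨U⟩₁ = add U` and `⟨U⟩ₙ = ⟨U⟩₁ ⋄ ⟨U⟩ₙ₋₁` for `n ≥ 2`. -/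
def gen (U : ObjectProperty C) : ℕ → ObjectProperty C
  | 0 => fun X => IsZero X
  | 1 => add U
  | n + 2 => diamond (add U) (gen U (n + 1))

variable (C) in
/-- The extension dimension of `C`: the infimum of the `n ≥ 0` such that `C = ⟨T⟩ₙ₊₁` for some
object `T`; it is `⊤` if there is no such `n`. -/
def extDim : ℕ∞ :=
  ⨅ (n : ℕ) (_ : ∃ T : C, gen (ObjectProperty.singleton T) (n + 1) = ⊤), (n : ℕ∞)

end Category

section Module

variable {R : Type u} [Ring R]

/-- Projective dimension of a module, with values in `{-1, 0, 1, …, ∞}`; the zero module has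
projective dimension `-1` (Mathlib's `projectiveDimension` takes the value `⊥` there). -/
def pd (M : ModuleCat.{v} R) : EReal :=
  WithBot.recBotCoe (-1) (fun n : ℕ∞ => ((n : ℝ≥0∞) : EReal)) (projectiveDimension M)

open Classical in
/-- Projective dimension of a class of finitely generated modules: the supremum of the projective
dimensions of its members, and `-1` for the empty class. -/
def pdClass (S : ObjectProperty (FGModuleCat.{v} R)) : EReal :=
  if ∃ M, S M then ⨆ (M : FGModuleCat.{v} R) (_ : S M), pd M.obj else -1

/-- The finitely generated simple modules that are not isomorphic to a member of `S`. -/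
def otherSimples (S : ObjectProperty (FGModuleCat.{v} R)) : ObjectProperty (FGModuleCat.{v} R) :=
  fun X => IsSimpleModule R X ∧ ∀ Y, S Y → IsEmpty (X ≅ Y)

/-- The class `𝒯_S` of the finitely generated modules `M` whose top `M / rad M` is in
`add` of the simple modules outside `S`. -/
def torsionClass (S : ObjectProperty (FGModuleCat.{v} R)) : ObjectProperty (FGModuleCat.{v} R) :=
  fun M => add (otherSimples S) (FGModuleCat.of R (M ⧸ Module.jacobson R M))

/-- The trace of a class `T` of modules in `M`: the sum of the images of all homomorphisms from
members of `T` to `M`. -/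
def trace (T : ObjectProperty (FGModuleCat.{v} R)) (M : ModuleCat.{v} R) : Submodule R M :=
  ⨆ (X : FGModuleCat.{v} R) (_ : T X) (f : X →ₗ[R] M), LinearMap.range f

/-- The action on objects of the functor `Trace_T`. -/
def traceObj (T : ObjectProperty (FGModuleCat.{v} R)) (M : ModuleCat.{v} R) : ModuleCat.{v} R :=
  ModuleCat.of R (trace T M)

/-- The action on objects of the functor `rad`. -/
def radObj (M : ModuleCat.{v} R) : ModuleCat.{v} R :=
  ModuleCat.of R (Module.jacobson R M)

/-- The `(α, β)`-layer length of `M`: the infimum of the `i ≥ 0` such that `α (βⁱ M) = 0`. It depends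
only on the action of the functors `α` and `β` on objects. -/
def layerLength (α β : ModuleCat.{v} R → ModuleCat.{v} R) (M : ModuleCat.{v} R) : ℕ∞ :=
  ⨅ (i : ℕ) (_ : IsZero (α (β^[i] M))), (i : ℕ∞)

/-- The `α`-radical layer length: the `(α, rad ∘ α)`-layer length. -/
def radicalLayerLength (α : ModuleCat.{v} R → ModuleCat.{v} R) (M : ModuleCat.{v} R) : ℕ∞ :=
  layerLength α (radObj ∘ α) M

end Module

end

end ExtDim

namespace ExtDim

/-! ### A linear form of `add` and `gen` -/

section Generation

variable {A : Type u} [Ring A]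

/-! Suppose both terms on the right are finite, put d = pd S + 1 and let n be the layer length.
Cutting Λ alternately at the trace and at its radical gives a filtration by n + 1 modules whose
composition factors lie in S, hence of projective dimension less than d, alternating with n
semisimple modules (`alternating_of_isZero`). Having such a filtration passes to quotients and
products, so every finitely generated module has one (`mem_of_regular`).

Pass to d-th syzygies. By the horseshoe lemma the filtration survives; the n + 1 factors of the
first kind become zero, and the semisimple ones, which lie in add(Λ/rad Λ), become modules in add of
one fixed module. So n layers suffice for the d-th syzygies (`exists_genL_of_alternating`).

Climbing back one syzygy costs one layer (`exists_genL_of_syzygy`). If K is the kernel of a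
projective cover P → M and K embeds in an injective I, then M ⊕ I is an extension of I/K by P. When
K needs n layers over T, so does I/K over a fixed T', because cosyzygies respect extensions and
summands; this requires finitely generated injectives (`exists_finite_injective`), where finiteness
over k is essential. After d steps every module lies in ⟨T⟩ with d + n layers, and the dimension is
at most d + n - 1 = pd S + n. -/

lemma exists_apply_comp_eq {M Q X : Type*} [AddCommGroup M] [Module A M] [AddCommGroup Q]
    [Module A Q] [AddCommGroup X] [Module A X] (g : M →ₗ[A] Q) (hg : Function.Surjective g)
    (h : M →ₗ[A] X) (hle : LinearMap.ker g ≤ LinearMap.ker h) :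
    ∃ r : Q →ₗ[A] X, ∀ x, r (g x) = h x := by
  refine ⟨(LinearMap.ker g).liftQ h hle ∘ₗ (g.quotKerEquivOfSurjective hg).symm.toLinearMap,
    fun x => ?_⟩
  have : (g.quotKerEquivOfSurjective hg).symm (g x) = Submodule.Quotient.mk x := by
    rw [LinearEquiv.symm_apply_eq]
    rfl
  change (LinearMap.ker g).liftQ h hle ((g.quotKerEquivOfSurjective hg).symm (g x)) = _
  rw [this]
  rfl

/-- Linear form of `add`: the identity of `M` is a finite sum of maps factoring through members
of `U`. -/
def addL (U : ObjectProperty (FGModuleCat.{u} A)) : ObjectProperty (FGModuleCat.{u} A) := fun M =>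
  ∃ (ι : Type) (_ : Fintype ι) (B : ι → FGModuleCat.{u} A) (i : ∀ k, M →ₗ[A] B k)
    (p : ∀ k, B k →ₗ[A] M), (∀ k, U (B k)) ∧ ∀ x, ∑ k, p k (i k x) = x

/-- The modules that are extensions of a module in `V` by a module in `U`. -/
def ext (U V : ObjectProperty (FGModuleCat.{u} A)) : ObjectProperty (FGModuleCat.{u} A) := fun M =>
  ∃ (N Q : FGModuleCat.{u} A) (f : N →ₗ[A] M) (g : M →ₗ[A] Q), Function.Injective f ∧
    Function.Surjective g ∧ Function.Exact f g ∧ U N ∧ V Q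

/-- Linear form of `gen`. -/
def genL (U : ObjectProperty (FGModuleCat.{u} A)) : ℕ → ObjectProperty (FGModuleCat.{u} A)
  | 0 => fun X => Subsingleton X
  | 1 => addL U
  | n + 2 => addL (ext (addL U) (genL U (n + 1)))

lemma shortExact_of_exact [IsNoetherianRing A] {N M Q : FGModuleCat.{u} A} (f : N →ₗ[A] M)
    (g : M →ₗ[A] Q) (hf : Function.Injective f) (hg : Function.Surjective g)
    (hfg : Function.Exact f g) :
    ∃ S : ShortComplex (FGModuleCat.{u} A), S.ShortExact ∧ S.X₁ = N ∧ S.X₂ = M ∧ S.X₃ = Q := by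
  let f' : N ⟶ M := FGModuleCat.ofHom f
  let g' : M ⟶ Q := FGModuleCat.ofHom g
  let S : ShortComplex (FGModuleCat.{u} A) := ShortComplex.mk f' g' (by
    ext x; exact hfg.apply_apply_eq_zero x)
  let G := forget₂ (FGModuleCat.{u} A) (ModuleCat.{u} A)
  have hS : (S.map G).ShortExact := by
    refine { exact := ?_, mono_f := ?_, epi_g := ?_ }
    · exact (ShortComplex.ShortExact.moduleCat_exact_iff_function_exact _).2 hfg
    · exact (ModuleCat.mono_iff_injective _).2 hf
    · exact (ModuleCat.epi_iff_surjective _).2 hg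
  refine ⟨S, ?_, rfl, rfl, rfl⟩
  refine { exact := ?_, mono_f := ?_, epi_g := ?_ }
  · exact (S.exact_map_iff_of_faithful G).1 hS.exact
  · exact G.mono_of_mono_map hS.mono_f
  · exact G.epi_of_epi_map hS.epi_g

lemma add_mono {U V : ObjectProperty (FGModuleCat.{u} A)} (h : ∀ M, U M → V M)
    (M : FGModuleCat.{u} A) (hM : add U M) : add V M := by
  obtain ⟨n, f, b, hf, h1, h2⟩ := hM
  exact ⟨n, f, b, fun i => h _ (hf i), h1, h2⟩

/-- The relation ∑ pₖ iₖ = id makes M a retract of the biproduct of the Bₖ. Only this direction is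
needed, since the theorem asserts membership in `gen`. -/
lemma add_of_addL [IsNoetherianRing A] {U : ObjectProperty (FGModuleCat.{u} A)}
    {M : FGModuleCat.{u} A} (hM : addL U M) : add U M := by
  obtain ⟨ι, _, B, i, p, hB, h⟩ := hM
  have := Abelian.hasFiniteBiproducts (C := FGModuleCat.{u} A)
  let e := Fintype.equivFin ι
  let f : Fin (Fintype.card ι) → FGModuleCat.{u} A := fun k => B (e.symm k)
  refine ⟨_, f, biproduct.bicone f, fun _ => hB _, ⟨biproduct.isBilimit f⟩, ⟨?_⟩⟩
  refine ⟨biproduct.lift fun k => FGModuleCat.ofHom (i (e.symm k)),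
    biproduct.desc fun k => FGModuleCat.ofHom (p (e.symm k)), ?_⟩
  erw [biproduct.lift_desc]
  rw [e.symm.sum_comp fun k => (FGModuleCat.ofHom (i k) ≫ FGModuleCat.ofHom (p k) : M ⟶ M)]
  ext x
  refine Eq.trans ?_ (h x)
  have key : ∀ s : Finset ι,
      (∑ k ∈ s, (FGModuleCat.ofHom (i k) ≫ FGModuleCat.ofHom (p k) : M ⟶ M)).hom.hom x
        = ∑ k ∈ s, p k (i k x) := by
    classical
    intro s
    induction s using Finset.induction_on with
    | empty => simp
    | insert a s ha ih => rw [Finset.sum_insert ha, Finset.sum_insert ha, ← ih]; rfl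
  exact key _

lemma gen_of_genL [IsNoetherianRing A] {U : ObjectProperty (FGModuleCat.{u} A)} (n : ℕ)
    (M : FGModuleCat.{u} A) (hM : genL U n M) : gen U n M := by
  induction n using Nat.twoStepInduction generalizing M with
  | zero =>
    have : Subsingleton M := hM
    exact (IsZero.iff_id_eq_zero M).2 (by ext x; exact Subsingleton.elim _ _)
  | one => exact add_of_addL hM
  | more n _ ih =>
    rw [gen, diamond]
    refine add_mono ?_ M (add_of_addL hM)
    rintro M ⟨N, Q, f, g, hf, hg, hfg, hN, hQ⟩
    obtain ⟨S, hS, h1, h2, h3⟩ := shortExact_of_exact f g hf hg hfg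
    exact ⟨S, hS, h2, h1 ▸ add_of_addL hN, h3 ▸ ih _ hQ⟩

lemma addL_of_mem {U : ObjectProperty (FGModuleCat.{u} A)} {M : FGModuleCat.{u} A} (hM : U M) :
    addL U M :=
  ⟨Unit, inferInstance, fun _ => M, fun _ => .id, fun _ => .id, fun _ => hM, fun x => by simp⟩

lemma addL_of_subsingleton {U : ObjectProperty (FGModuleCat.{u} A)} {M : FGModuleCat.{u} A}
    (hM : Subsingleton M) : addL U M :=
  ⟨Empty, inferInstance, fun _ => M, fun _ => .id, fun _ => .id, nofun,
    fun _ => Subsingleton.elim _ _⟩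

lemma addL_of_retract {U : ObjectProperty (FGModuleCat.{u} A)} {M N : FGModuleCat.{u} A}
    (hN : addL U N) (i : M →ₗ[A] N) (p : N →ₗ[A] M) (h : ∀ x, p (i x) = x) : addL U M := by
  obtain ⟨ι, _, B, i', p', hB, h'⟩ := hN
  exact ⟨ι, inferInstance, B, fun k => i' k ∘ₗ i, fun k => p ∘ₗ p' k, hB, fun x => by
    simp [← map_sum, h', h]⟩

lemma addL_of_addL {U V : ObjectProperty (FGModuleCat.{u} A)} (h : ∀ M, U M → addL V M)
    (M : FGModuleCat.{u} A) (hM : addL U M) : addL V M := by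
  obtain ⟨ι, _, B, i, p, hB, hM⟩ := hM
  choose κ hκ C j q hC hj using fun k => h _ (hB k)
  refine ⟨Σ k, κ k, inferInstance, fun x => C x.1 x.2, fun x => j x.1 x.2 ∘ₗ i x.1,
    fun x => p x.1 ∘ₗ q x.1 x.2, fun x => hC _ _, fun x => ?_⟩
  rw [Fintype.sum_sigma]
  refine Eq.trans (Finset.sum_congr rfl fun k _ => ?_) (hM x)
  exact (map_sum (p k) _ _).symm.trans (congrArg (p k) (hj k (i k x)))

lemma addL_mono {U V : ObjectProperty (FGModuleCat.{u} A)} (h : ∀ M, U M → V M)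
    (M : FGModuleCat.{u} A) (hM : addL U M) : addL V M :=
  addL_of_addL (fun M hM => addL_of_mem (h M hM)) M hM

lemma addL_prod {U : ObjectProperty (FGModuleCat.{u} A)} {M N : FGModuleCat.{u} A}
    (hM : addL U M) (hN : addL U N) : addL U (FGModuleCat.of A (M × N)) := by
  obtain ⟨ι, _, B, i, p, hB, hM⟩ := hM
  obtain ⟨κ, _, C, j, q, hC, hN⟩ := hN
  refine ⟨ι ⊕ κ, inferInstance, Sum.elim B C,
    fun | .inl k => i k ∘ₗ .fst A M N | .inr k => j k ∘ₗ .snd A M N,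
    fun | .inl k => .inl A M N ∘ₗ p k | .inr k => .inr A M N ∘ₗ q k,
    fun | .inl k => hB k | .inr k => hC k, fun x => ?_⟩
  rw [Fintype.sum_sum_type]
  refine Prod.ext ?_ ?_
  · rw [Prod.fst_add, Prod.fst_sum, Prod.fst_sum]
    change ∑ k, p k (i k x.1) + ∑ k : κ, (0 : M) = x.1
    simp [hM]
  · rw [Prod.snd_add, Prod.snd_sum, Prod.snd_sum]
    change ∑ k : ι, (0 : N) + ∑ k, q k (j k x.2) = x.2
    simp [hN]

lemma addL_pi {U : ObjectProperty (FGModuleCat.{u} A)} {ι : Type} [Fintype ι]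
    {B : ι → FGModuleCat.{u} A} (hB : ∀ k, addL U (B k)) :
    addL U (FGModuleCat.of A (∀ k, B k)) := by
  classical
  refine addL_of_addL (U := fun N => ∃ k, N = B k) (fun N ⟨k, hk⟩ => hk ▸ hB k) _ ?_
  refine ⟨ι, inferInstance, B, fun k => .proj k, fun k => .single A (fun k => B k) k,
    fun k => ⟨k, rfl⟩, fun x => ?_⟩
  exact LinearMap.sum_single_apply (fun k => B k) x

lemma addL_of_sum {U : ObjectProperty (FGModuleCat.{u} A)} {M P : FGModuleCat.{u} A}
    (hP : addL U P) {ι : Type} [Fintype ι] {B : ι → FGModuleCat.{u} A} (hB : ∀ k, addL U (B k))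
    (i : ∀ k, M →ₗ[A] B k) (p : ∀ k, B k →ₗ[A] M) (j : M →ₗ[A] P) (q : P →ₗ[A] M)
    (h : ∀ x, q (j x) + ∑ k, p k (i k x) = x) : addL U M := by
  refine addL_of_addL (U := addL U) (fun _ => id) _ ?_
  refine ⟨Option ι, inferInstance, fun o => o.elim P B,
    fun | none => j | some k => i k, fun | none => q | some k => p k,
    fun | none => hP | some k => hB k, fun x => ?_⟩
  rw [Fintype.sum_option]
  exact h x

lemma ext_mono {U V U' V' : ObjectProperty (FGModuleCat.{u} A)} (h : ∀ M, U M → U' M)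
    (h' : ∀ M, V M → V' M) (M : FGModuleCat.{u} A) (hM : ext U V M) : ext U' V' M := by
  obtain ⟨N, Q, f, g, hf, hg, hfg, hN, hQ⟩ := hM
  exact ⟨N, Q, f, g, hf, hg, hfg, h _ hN, h' _ hQ⟩

lemma genL_mono {U V : ObjectProperty (FGModuleCat.{u} A)} (h : ∀ M, U M → addL V M) (n : ℕ) :
    ∀ M, genL U n M → genL V n M := by
  induction n using Nat.twoStepInduction with
  | zero => exact fun M hM => hM
  | one => exact addL_of_addL h
  | more n _ ih => exact addL_mono (ext_mono (addL_of_addL h) ih)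

lemma genL_of_subsingleton {U : ObjectProperty (FGModuleCat.{u} A)} (n : ℕ) {M : FGModuleCat.{u} A}
    (hM : Subsingleton M) : genL U n M :=
  match n with
  | 0 => hM
  | 1 => addL_of_subsingleton hM
  | _ + 2 => addL_of_subsingleton hM

lemma genL_of_retract {U : ObjectProperty (FGModuleCat.{u} A)} (n : ℕ) {M N : FGModuleCat.{u} A}
    (hN : genL U n N) (i : M →ₗ[A] N) (p : N →ₗ[A] M) (h : ∀ x, p (i x) = x) : genL U n M :=
  match n, hN with
  | 0, hN => have : Subsingleton N := hN
    (Function.LeftInverse.injective h).subsingleton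
  | 1, hN => addL_of_retract hN i p h
  | _ + 2, hN => addL_of_retract hN i p h

end Generation

/-! ### Finitely generated injectives over an artin algebra -/

section InjectiveHull

variable {k : Type w} [CommRing k] [IsArtinianRing k] {A : Type u} [Ring A] [Algebra k A]

/-- If every nonzero submodule of `E` meets `M`, homomorphisms from a module of finite length to `E`
form a finitely generated `k`-module when `M` is finitely generated over `k`. -/
lemma isNoetherian_hom_of_essential {E : Type*} [AddCommGroup E] [Module A E] [Module k E]
    [IsScalarTower k A E] (M : Submodule A E)
    (hM : ∀ N : Submodule A E, N ⊓ M = ⊥ → N = ⊥) [IsNoetherian k (M.restrictScalars k)]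
    {N : Type*} [AddCommGroup N] [Module A N] (hN : IsFiniteLength A N) :
    haveI : SMulCommClass A k E := IsScalarTower.to_smulCommClass' (R := k)
    IsNoetherian k (N →ₗ[A] E) := by
  have : SMulCommClass A k E := IsScalarTower.to_smulCommClass' (R := k)
  induction hN with
  | of_subsingleton => infer_instance
  | @of_simple_quotient N _ _ N' _ _ ih =>
    have hQ : IsNoetherian k ((N ⧸ N') →ₗ[A] E) := by
      have := IsSimpleModule.nontrivial A (N ⧸ N')
      obtain ⟨x, hx⟩ := exists_ne (0 : N ⧸ N')
      have hx' := IsSimpleModule.span_singleton_eq_top A hx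
      -- A nonzero map from a simple module has image meeting M, so its whole image lies in M.
      -- Evaluation at a generator then embeds the Hom module in M.
      have hmem : ∀ f : (N ⧸ N') →ₗ[A] E, f x ∈ M := by
        intro f
        rcases LinearMap.injective_or_eq_zero f with hf | hf
        · have h1 : LinearMap.range f ⊓ M ≠ ⊥ := fun h => by
            have h2 := hM _ h
            rw [LinearMap.range_eq_bot] at h2
            exact hx (hf (by simp [h2]))
          have h3 : M.comap f ≠ ⊥ := fun h => h1 (by
            rw [eq_bot_iff]
            rintro _ ⟨⟨y, rfl⟩, hy⟩
            have : y ∈ M.comap f := hy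
            rw [h] at this
            simp [(Submodule.mem_bot A).1 this])
          have h4 : M.comap f = ⊤ := (eq_bot_or_eq_top _).resolve_left h3
          have : x ∈ M.comap f := h4 ▸ Submodule.mem_top
          exact this
        · simp [hf]
      let ev : ((N ⧸ N') →ₗ[A] E) →ₗ[k] M.restrictScalars k :=
        { toFun := fun f => ⟨f x, hmem f⟩
          map_add' := fun f g => rfl
          map_smul' := fun c f => rfl }
      refine isNoetherian_of_injective ev fun f g hfg => ?_
      refine LinearMap.ext_on (s := {x}) hx' ?_
      rintro _ rfl
      exact congrArg Subtype.val hfg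
    let r : (N →ₗ[A] E) →ₗ[k] (N' →ₗ[A] E) :=
      { toFun := fun f => f ∘ₗ N'.subtype
        map_add' := fun f g => rfl
        map_smul' := fun c f => rfl }
    let s : ((N ⧸ N') →ₗ[A] E) →ₗ[k] (N →ₗ[A] E) :=
      { toFun := fun f => f ∘ₗ N'.mkQ
        map_add' := fun f g => rfl
        map_smul' := fun c f => rfl }
    refine isNoetherian_of_range_eq_ker s r ?_
    ext f
    constructor
    · rintro ⟨g, rfl⟩
      refine LinearMap.ext fun x => ?_
      change g (N'.mkQ x) = 0
      rw [Submodule.mkQ_apply, (Submodule.Quotient.mk_eq_zero N').2 x.2, map_zero]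
    · intro hf
      refine ⟨N'.liftQ f fun x hx => ?_, N'.liftQ_mkQ f _⟩
      exact DFunLike.congr_fun (show f ∘ₗ N'.subtype = 0 from hf) ⟨x, hx⟩

include k in
/-- An essential extension of a finitely generated module over an artin algebra is finitely
generated. -/
lemma finite_of_essential [Module.Finite k A] {I : Type*} [AddCommGroup I] [Module A I]
    (M : Submodule A I) [Module.Finite A M] (hM : ∀ N : Submodule A I, N ⊓ M = ⊥ → N = ⊥) :
    Module.Finite A I := by
  let _ : Module k I := Module.compHom I (algebraMap k A)
  have : IsScalarTower k A I := ⟨fun c a x => by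
    change (c • a) • x = algebraMap k A c • a • x
    rw [Algebra.smul_def, mul_smul]⟩
  have : IsArtinianRing A := IsArtinianRing.of_finite k A
  have : Module.Finite k M := Module.Finite.trans A M
  have : IsNoetherian k (M.restrictScalars k) :=
    inferInstanceAs (IsNoetherian k M)
  have : SMulCommClass A k I := IsScalarTower.to_smulCommClass' (R := k)
  -- I is recovered as Hom(A, I), and A has finite length.
  have h := isNoetherian_hom_of_essential (k := k) M hM (N := A)
    (isFiniteLength_iff_isNoetherian_isArtinian.2 ⟨inferInstance, inferInstance⟩)
  let ev : (A →ₗ[A] I) →ₗ[k] I :=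
    { toFun := fun f => f 1
      map_add' := fun f g => rfl
      map_smul' := fun c f => rfl }
  have : Module.Finite k I := Module.Finite.of_surjective ev fun x =>
    ⟨LinearMap.toSpanSingleton A I x, by simp [ev]⟩
  exact Module.Finite.of_restrictScalars_finite k A I

include k in
/-- Finitely generated modules over an artin algebra embed in finitely generated injective
modules. -/
theorem exists_finite_injective [Module.Finite k A] (M : Type u) [AddCommGroup M] [Module A M]
    [Module.Finite A M] :
    ∃ (E : FGModuleCat.{u} A) (j : M →ₗ[A] E), Function.Injective j ∧ Module.Injective A E := by
  have : IsArtinianRing A := IsArtinianRing.of_finite k A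
  have := ModuleCat.enoughInjectives.{u, u} A
  let J := Injective.under (ModuleCat.of A M)
  let i : M →ₗ[A] J := (Injective.ι (ModuleCat.of A M)).hom
  have hi : Function.Injective i := (ModuleCat.mono_iff_injective _).1 inferInstance
  have hJ' : Injective (ModuleCat.of A J) := Injective.injective_under (ModuleCat.of A M)
  have hJ : Module.Injective A J := Module.injective_module_of_injective_object A J
  -- a maximal complement `C` of `M`
  obtain ⟨C, -, hC⟩ : ∃ C, (⊥ : Submodule A J) ≤ C ∧
      Maximal (fun C => Disjoint (LinearMap.range i) C) C := by
    refine zorn_le_nonempty₀ {C | Disjoint (LinearMap.range i) C} ?_ ⊥ disjoint_bot_right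
    intro c hc hchain y hy
    refine ⟨sSup c, ?_, fun z hz => le_sSup hz⟩
    exact (hchain.directedOn.disjoint_sSup_right).2 fun b hb => hc hb
  have hCinj : Function.Injective (C.mkQ ∘ₗ i) := by
    rw [← LinearMap.ker_eq_bot, LinearMap.ker_comp, Submodule.ker_mkQ, eq_bot_iff]
    intro x hx
    have h0 : i x = 0 := (Submodule.disjoint_def.1 hC.1) _ ⟨x, rfl⟩ hx
    exact hi (by simpa using h0)
  -- The preimage of N in J contains C and is still disjoint from M, so it equals C by maximality.
  have hess : ∀ N : Submodule A (J ⧸ C), N ⊓ LinearMap.range (C.mkQ ∘ₗ i) = ⊥ → N = ⊥ := by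
    intro N hN
    have h1 : Disjoint (LinearMap.range i) (N.comap C.mkQ) := by
      rw [Submodule.disjoint_def]
      rintro _ ⟨x, rfl⟩ hx
      have h2 : C.mkQ (i x) ∈ N ⊓ LinearMap.range (C.mkQ ∘ₗ i) := ⟨hx, x, rfl⟩
      rw [hN, Submodule.mem_bot] at h2
      have h3 : x = 0 := hCinj (by simpa using h2)
      simp [h3]
    have h2 := hC.2 h1 (Submodule.le_comap_mkQ C N)
    rw [eq_bot_iff]
    intro y hy
    obtain ⟨z, rfl⟩ := C.mkQ_surjective y
    have h3 : z ∈ C := h2 hy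
    simpa using h3
  have hfin : Module.Finite A (J ⧸ C) := finite_of_essential (k := k) _ hess
  -- `J ⧸ C` embeds in `J`, and the composite endomorphism of `J ⧸ C` is bijective
  obtain ⟨h, hh⟩ := Module.Injective.extension_property A J _ _ _ hCinj i
  have hh' : ∀ x, h (C.mkQ (i x)) = i x := fun x => DFunLike.congr_fun hh x
  have hb : Function.Injective (C.mkQ ∘ₗ h) := by
    rw [← LinearMap.ker_eq_bot]
    apply hess
    rw [eq_bot_iff]
    rintro _ ⟨hx, x, rfl⟩
    have h1 : C.mkQ (h (C.mkQ (i x))) = 0 := hx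
    rw [hh'] at h1
    simpa using h1
  let e := LinearEquiv.ofBijective _ (IsArtinian.bijective_of_injective_endomorphism _ hb)
  refine ⟨FGModuleCat.of A (J ⧸ C), C.mkQ ∘ₗ i, hCinj, ⟨fun X Y _ _ _ _ f hf g => ?_⟩⟩
  -- `J ⧸ C` is a retract of J through h and `e.symm ∘ C.mkQ`, so it inherits injectivity.
  obtain ⟨l, hl⟩ := Module.Injective.extension_property A J _ _ f hf (h ∘ₗ g)
  refine ⟨e.symm.toLinearMap ∘ₗ C.mkQ ∘ₗ l, fun x => ?_⟩
  have h1 : l (f x) = h (g x) := DFunLike.congr_fun hl x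
  change e.symm (C.mkQ (l (f x))) = g x
  rw [h1, LinearEquiv.symm_apply_eq]
  rfl

end InjectiveHull

/-! ### Syzygies and cosyzygies of extensions and summands -/

section Syzygies

variable {A : Type u} [Ring A]

/-- The modules in `U` have syzygies in `U'`, for a cover by a finitely generated projective
module that is a summand of a free module. -/
def HasSyzygiesIn [IsNoetherianRing A] (U U' : ObjectProperty (FGModuleCat.{u} A)) : Prop :=
  ∀ M, U M → ∃ (P : FGModuleCat.{u} A) (p : P →ₗ[A] M), Module.Projective A P ∧
    addL (· = FGModuleCat.of A A) P ∧ Function.Surjective p ∧ U' (FGModuleCat.of A (LinearMap.ker p))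

/-- The modules in `U` have cosyzygies in `U'`, for an embedding in an injective module in
`add E`. -/
def HasCosyzygiesIn (E : FGModuleCat.{u} A) (U U' : ObjectProperty (FGModuleCat.{u} A)) : Prop :=
  ∀ M, U M → ∃ (I : FGModuleCat.{u} A) (j : M →ₗ[A] I), Module.Injective A I ∧
    addL (· = E) I ∧ Function.Injective j ∧ U' (FGModuleCat.of A (I ⧸ LinearMap.range j))

lemma exists_projective_cover (M : FGModuleCat.{u} A) :
    ∃ (P : FGModuleCat.{u} A) (p : P →ₗ[A] M), Module.Projective A P ∧
      addL (· = FGModuleCat.of A A) P ∧ Function.Surjective p := by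
  obtain ⟨n, p, hp⟩ := Module.Finite.exists_fin' A M
  exact ⟨FGModuleCat.of A (Fin n → A), p,
    inferInstanceAs (Module.Projective A (Fin n → A)),
    addL_pi (B := fun _ => FGModuleCat.of A A) fun _ => addL_of_mem rfl, hp⟩

section Noetherian

variable [IsNoetherianRing A]

/-- Horseshoe lemma: the cover of Q lifts to M, and the kernels form an exact sequence. -/
lemma HasSyzygiesIn.ext {U V U' V' : ObjectProperty (FGModuleCat.{u} A)}
    (hU : HasSyzygiesIn U U') (hV : HasSyzygiesIn V V') :
    HasSyzygiesIn (ext U V) (ext U' V') := by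
  rintro M ⟨N, Q, f, g, hf, hg, hfg, hN, hQ⟩
  obtain ⟨P, p, hP, hP', hp, hpU⟩ := hU N hN
  obtain ⟨P₂, q, hP₂, hP₂', hq, hqV⟩ := hV Q hQ
  obtain ⟨q', hq'⟩ := Module.projective_lifting_property g q hg
  have hq' (x) : g (q' x) = q x := DFunLike.congr_fun hq' x
  let r : P × P₂ →ₗ[A] M := (f ∘ₗ p).coprod q'
  have hr (x) : r x = f (p x.1) + q' x.2 := rfl
  have hgr (x) : g (r x) = q x.2 := by
    rw [hr, map_add, hfg.apply_apply_eq_zero, hq', zero_add]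
  refine ⟨FGModuleCat.of A (P × P₂), r, inferInstanceAs (Module.Projective A (P × P₂)),
    addL_prod hP' hP₂', fun m => ?_, ?_⟩
  · obtain ⟨y, hy⟩ := hq (g m)
    obtain ⟨n, hn⟩ := (hfg (m - q' y)).1 (by rw [map_sub, hq', hy, sub_self])
    obtain ⟨x, rfl⟩ := hp n
    exact ⟨(x, y), by rw [hr, hn, sub_add_cancel]⟩
  · have h1 : ∀ x ∈ LinearMap.ker p, LinearMap.inl A P P₂ x ∈ LinearMap.ker r := by
      intro x hx
      rw [LinearMap.mem_ker] at hx ⊢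
      simp [hr, hx]
    have h2 : ∀ x ∈ LinearMap.ker r, LinearMap.snd A P P₂ x ∈ LinearMap.ker q := by
      intro x hx
      rw [LinearMap.mem_ker] at hx ⊢
      rw [LinearMap.snd_apply, ← hgr, hx, map_zero]
    refine ⟨_, _, (LinearMap.inl A P P₂).restrict h1, (LinearMap.snd A P P₂).restrict h2,
      ?_, ?_, ?_, hpU, hqV⟩
    · intro x y hxy
      exact Subtype.ext (congrArg (fun z => z.1.1) hxy)
    · rintro ⟨y, hy⟩
      rw [LinearMap.mem_ker] at hy
      obtain ⟨n, hn⟩ := (hfg (q' y)).1 (by rw [hq', hy])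
      obtain ⟨x, rfl⟩ := hp n
      refine ⟨⟨(-x, y), ?_⟩, rfl⟩
      rw [LinearMap.mem_ker, hr]
      simp [hn]
    · rintro ⟨⟨x, y⟩, hxy⟩
      constructor
      · intro h
        have hy : y = 0 := congrArg Subtype.val h
        subst hy
        refine ⟨⟨x, ?_⟩, rfl⟩
        rw [LinearMap.mem_ker] at hxy ⊢
        rw [hr] at hxy
        exact hf (by simpa using hxy)
      · rintro ⟨z, hz⟩
        rw [← hz]
        rfl

/-- A Schanuel-type comparison. Lift iₖ and πₖ to maps aₖ, bₖ between the covers. The defect id - ∑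
bₖ aₖ sends P into ker p, so on ker p the identity is a sum of maps through P and through the
syzygies of the Bₖ. The stray summand P is why A must lie in `addL U'`. -/
lemma HasSyzygiesIn.addL {U U' : ObjectProperty (FGModuleCat.{u} A)} (hU : HasSyzygiesIn U U')
    (hA : addL U' (FGModuleCat.of A A)) : HasSyzygiesIn (addL U) (addL U') := by
  rintro M ⟨ι, _, B, i, π, hB, hM⟩
  obtain ⟨P, p, hP, hP', hp⟩ := exists_projective_cover M
  refine ⟨P, p, hP, hP', hp, ?_⟩
  choose Q q hQ _ hq hqU using fun k => hU _ (hB k)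
  choose a ha using fun k => Module.projective_lifting_property (q k) (i k ∘ₗ p) (hq k)
  choose b hb using fun k => Module.projective_lifting_property p (π k ∘ₗ q k) hp
  have ha (k x) : q k (a k x) = i k (p x) := DFunLike.congr_fun (ha k) x
  have hb (k x) : p (b k x) = π k (q k x) := DFunLike.congr_fun (hb k) x
  have h1 (k) : ∀ x ∈ LinearMap.ker p, a k x ∈ LinearMap.ker (q k) := fun x hx => by
    rw [LinearMap.mem_ker] at hx ⊢
    rw [ha, hx, map_zero]
  have h2 (k) : ∀ x ∈ LinearMap.ker (q k), b k x ∈ LinearMap.ker p := fun x hx => by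
    rw [LinearMap.mem_ker] at hx ⊢
    rw [hb, hx, map_zero]
  have h3 : ∀ x, (LinearMap.id - ∑ k, b k ∘ₗ a k : P →ₗ[A] P) x ∈ LinearMap.ker p := fun x => by
    rw [LinearMap.mem_ker]
    simp [ha, hb, hM, LinearMap.sum_apply]
  refine addL_of_sum (P := P) (B := fun k => FGModuleCat.of A (LinearMap.ker (q k)))
    (addL_of_addL (fun N hN => hN ▸ hA) _ hP') (fun k => addL_of_mem (hqU k))
    (fun k => (a k).restrict (h1 k)) (fun k => (b k).restrict (h2 k)) (LinearMap.ker p).subtype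
    (LinearMap.codRestrict _ _ h3) fun x => ?_
  refine Subtype.ext ?_
  refine (map_add (LinearMap.ker p).subtype _ _).trans ?_
  rw [map_sum]
  change x.1 - (∑ k, b k ∘ₗ a k : P →ₗ[A] P) x.1 + ∑ k, b k (a k x.1) = x.1
  simp [LinearMap.sum_apply]

end Noetherian

/-- Dual horseshoe lemma, extending the embedding of N to M by injectivity. -/
lemma HasCosyzygiesIn.ext {E : FGModuleCat.{u} A} {U V U' V' : ObjectProperty (FGModuleCat.{u} A)}
    (hU : HasCosyzygiesIn E U U') (hV : HasCosyzygiesIn E V V') :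
    HasCosyzygiesIn E (ext U V) (ext U' V') := by
  rintro M ⟨N, Q, f, g, hf, hg, hfg, hN, hQ⟩
  obtain ⟨I, j, hI, hI', hj, hjU⟩ := hU N hN
  obtain ⟨I₂, l, hI₂, hI₂', hl, hlV⟩ := hV Q hQ
  obtain ⟨j', hj'⟩ := Module.Injective.extension_property A I _ _ f hf j
  have hj' (x) : j' (f x) = j x := DFunLike.congr_fun hj' x
  let J : M →ₗ[A] I × I₂ := j'.prod (l ∘ₗ g)
  have hJ (x) : J x = (j' x, l (g x)) := rfl
  have hJf (x) : J (f x) = (j x, 0) := by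
    rw [hJ, hj', hfg.apply_apply_eq_zero, map_zero]
  have h1 : LinearMap.range j ≤ (LinearMap.range J).comap (LinearMap.inl A I I₂) := by
    rintro _ ⟨x, rfl⟩
    exact ⟨f x, hJf x⟩
  have h2 : LinearMap.range J ≤ (LinearMap.range l).comap (LinearMap.snd A I I₂) := by
    rintro _ ⟨x, rfl⟩
    exact ⟨g x, rfl⟩
  have hinj : Module.Injective A (I × I₂) := ⟨fun X Y _ _ _ _ s hs t => by
    obtain ⟨a, ha⟩ := Module.Injective.extension_property A I _ _ s hs (.fst A I I₂ ∘ₗ t)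
    obtain ⟨b, hb⟩ := Module.Injective.extension_property A I₂ _ _ s hs (.snd A I I₂ ∘ₗ t)
    exact ⟨a.prod b, fun x => Prod.ext (DFunLike.congr_fun ha x) (DFunLike.congr_fun hb x)⟩⟩
  refine ⟨FGModuleCat.of A (I × I₂), J, hinj, addL_prod hI' hI₂', fun x y hxy => ?_, ?_⟩
  · have h3 : g (x - y) = 0 := by
      rw [map_sub, sub_eq_zero]
      exact hl (congrArg Prod.snd hxy)
    obtain ⟨n, hn⟩ := (hfg _).1 h3
    have h4 : J (f n) = 0 := by rw [hn, map_sub, hxy, sub_self]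
    rw [hJf] at h4
    have h5 : n = 0 := hj (by simpa using congrArg Prod.fst h4)
    rw [h5, map_zero] at hn
    exact sub_eq_zero.1 hn.symm
  · refine ⟨_, _, Submodule.mapQ _ _ _ h1, Submodule.mapQ _ _ _ h2, ?_, ?_, ?_, hjU, hlV⟩
    · rw [injective_iff_map_eq_zero]
      intro x hx
      obtain ⟨x, rfl⟩ := Submodule.Quotient.mk_surjective _ x
      rw [Submodule.mapQ_apply, Submodule.Quotient.mk_eq_zero] at hx
      obtain ⟨m, hm⟩ := hx
      rw [Submodule.Quotient.mk_eq_zero]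
      have hm2 : g m = 0 := hl ((congrArg Prod.snd hm).trans (map_zero l).symm)
      obtain ⟨n, rfl⟩ := (hfg _).1 hm2
      rw [hJf] at hm
      exact ⟨n, congrArg Prod.fst hm⟩
    · intro y
      obtain ⟨y, rfl⟩ := Submodule.Quotient.mk_surjective _ y
      exact ⟨Submodule.Quotient.mk (0, y), rfl⟩
    · intro z
      obtain ⟨⟨x, y⟩, rfl⟩ := Submodule.Quotient.mk_surjective _ z
      constructor
      · intro h
        rw [Submodule.mapQ_apply, Submodule.Quotient.mk_eq_zero] at h
        obtain ⟨q, hq⟩ := h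
        obtain ⟨m, rfl⟩ := hg q
        refine ⟨Submodule.Quotient.mk (x - j' m), ?_⟩
        rw [Submodule.mapQ_apply, Submodule.Quotient.eq]
        refine ⟨-m, ?_⟩
        have hq : l (g m) = y := hq
        rw [hJ]
        ext <;> simp [hq]
      · rintro ⟨n, hn⟩
        obtain ⟨n, rfl⟩ := Submodule.Quotient.mk_surjective _ n
        rw [← hn, Submodule.mapQ_apply, Submodule.mapQ_apply]
        exact (Submodule.Quotient.mk_eq_zero _).2 (zero_mem _)

/-- Dual comparison: id - ∑ cₖ prₖ kills the image of M, so on the cokernel the identity factors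
through I and the given cosyzygies. -/
lemma HasCosyzygiesIn.addL {E : FGModuleCat.{u} A} {U U' : ObjectProperty (FGModuleCat.{u} A)}
    (hU : HasCosyzygiesIn E U U') (hE : addL U' E) :
    HasCosyzygiesIn E (addL U) (addL U') := by
  rintro M ⟨ι, _, B, i, π, hB, hM⟩
  choose J j hJ hJ' hj hjU using fun k => hU _ (hB k)
  let I := FGModuleCat.of A (∀ k, J k)
  have hI : Module.Injective A I := inferInstanceAs (Module.Injective A (∀ k, J k))
  have hI' : ExtDim.addL (· = E) I := addL_pi hJ'
  let e : M →ₗ[A] I := LinearMap.pi fun k => j k ∘ₗ i k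
  let pr (k) : I →ₗ[A] J k := LinearMap.proj k
  have he (k x) : pr k (e x) = j k (i k x) := rfl
  have heinj : Function.Injective e := by
    intro x y hxy
    rw [← hM x, ← hM y]
    exact Finset.sum_congr rfl fun k _ => congrArg (π k) (hj k (by rw [← he, hxy, he]))
  choose c hc using fun k =>
    Module.Injective.extension_property A I _ _ (j k) (hj k) (e ∘ₗ π k)
  have hc (k x) : c k (j k x) = e (π k x) := DFunLike.congr_fun (hc k) x
  have h1 (k) : LinearMap.range e ≤ (LinearMap.range (j k)).comap (pr k) := by
    rintro _ ⟨x, rfl⟩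
    exact ⟨i k x, rfl⟩
  have h2 (k) : LinearMap.range (j k) ≤ (LinearMap.range e).comap (c k) := by
    rintro _ ⟨x, rfl⟩
    exact ⟨π k x, (hc k x).symm⟩
  have h3 : LinearMap.range e ≤ LinearMap.ker (LinearMap.id - ∑ k, c k ∘ₗ pr k : I →ₗ[A] I) := by
    rintro _ ⟨x, rfl⟩
    rw [LinearMap.mem_ker]
    simp [LinearMap.sum_apply, he, hc, ← map_sum, hM]
  refine ⟨I, e, hI, hI', heinj, ?_⟩
  refine addL_of_sum (P := I) (B := fun k => FGModuleCat.of A (J k ⧸ LinearMap.range (j k)))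
    (addL_of_addL (fun N hN => hN ▸ hE) _ hI') (fun k => addL_of_mem (hjU k))
    (fun k => Submodule.mapQ _ _ _ (h1 k)) (fun k => Submodule.mapQ _ _ _ (h2 k))
    (Submodule.liftQ _ _ h3) (Submodule.mkQ _) fun x => ?_
  obtain ⟨x, rfl⟩ := Submodule.mkQ_surjective _ x
  have h4 : (Submodule.mkQ (LinearMap.range e)) (∑ k, c k (pr k x)) =
      ∑ k, (Submodule.mkQ (LinearMap.range e)) (c k (pr k x)) := map_sum _ _ _
  change (Submodule.mkQ (LinearMap.range e)) (x - (∑ k, c k ∘ₗ pr k : I →ₗ[A] I) x) +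
    ∑ k, (Submodule.mkQ (LinearMap.range e)) (c k (pr k x)) = _
  rw [← h4, ← map_add]
  simp [LinearMap.sum_apply]

lemma HasCosyzygiesIn.genL {E : FGModuleCat.{u} A} {U U' : ObjectProperty (FGModuleCat.{u} A)}
    (hU : HasCosyzygiesIn E U U') (hE : ExtDim.addL U' E) (n : ℕ) :
    HasCosyzygiesIn E (genL U n) (genL U' n) := by
  induction n using Nat.twoStepInduction with
  | zero =>
    intro M hM
    have : Subsingleton M := hM
    have h0 : Subsingleton (FGModuleCat.of A PUnit.{u + 1}) :=
      inferInstanceAs (Subsingleton PUnit)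
    have h1 : Subsingleton ((FGModuleCat.of A PUnit.{u + 1}) ⧸
      LinearMap.range (0 : M →ₗ[A] FGModuleCat.of A PUnit.{u + 1})) :=
        (Submodule.mkQ_surjective _).subsingleton
    exact ⟨FGModuleCat.of A PUnit, 0, ⟨fun X Y _ _ _ _ _ _ _ => ⟨0, fun _ => Subsingleton.elim _ _⟩⟩,
      addL_of_subsingleton h0, Function.injective_of_subsingleton _, h1⟩
  | one => exact hU.addL hE
  | more n _ ih =>
    -- The comparison needs E in the target class; E is an extension of 0 by itself.
    refine ((hU.addL hE).ext ih).addL (addL_of_mem ?_)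
    exact ⟨E, FGModuleCat.of A PUnit, LinearMap.id, 0, Function.injective_id,
      fun x => ⟨0, Subsingleton.elim _ _⟩, fun x => ⟨fun _ => ⟨x, rfl⟩, fun _ => rfl⟩, hE,
      genL_of_subsingleton _ (inferInstanceAs (Subsingleton PUnit))⟩

end Syzygies

/-! ### Trading syzygies for extensions -/

section Step

variable {A : Type u} [Ring A]

lemma addL_of_equiv {U : ObjectProperty (FGModuleCat.{u} A)} {M N : FGModuleCat.{u} A}
    (hN : addL U N) (e : M ≃ₗ[A] N) : addL U M :=
  addL_of_retract hN e.toLinearMap e.symm.toLinearMap e.symm_apply_apply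

/-- If the kernel `K` of a projective cover of `M` embeds in an injective module `I`, then
`M × I` is an extension of `I / K` by the cover. -/
lemma ext_of_embedding_ker {U V : ObjectProperty (FGModuleCat.{u} A)} {P M I : FGModuleCat.{u} A}
    (p : P →ₗ[A] M) (hp : Function.Surjective p) (hI : Module.Injective A I)
    (j : LinearMap.ker p →ₗ[A] I) (hj : Function.Injective j) (hP : U P)
    (hV : V (FGModuleCat.of A (I ⧸ LinearMap.range j))) : ext U V (FGModuleCat.of A (M × I)) := by
  obtain ⟨j', hj'⟩ := Module.Injective.extension_property A I _ _ (LinearMap.ker p).subtype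
    (LinearMap.ker p).subtype_injective j
  have hj' (x : LinearMap.ker p) : j' x = j x := DFunLike.congr_fun hj' x
  have hle : LinearMap.ker p ≤ LinearMap.ker ((LinearMap.range j).mkQ ∘ₗ j') := fun x hx => by
    rw [LinearMap.mem_ker, LinearMap.comp_apply, hj' ⟨x, hx⟩]
    simp
  obtain ⟨φ, hφ⟩ := exists_apply_comp_eq p hp _ hle
  -- M × I is the pushout of P and I along the kernel of p: its sequence with sub I and quotient M
  -- splits because j extends to P. The sign makes g ∘ f vanish.
  let f : P →ₗ[A] M × I := p.prod (-j')
  let g : M × I →ₗ[A] I ⧸ LinearMap.range j := φ.coprod (LinearMap.range j).mkQ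
  have hg (x y) : g (p x, y) = (LinearMap.range j).mkQ (j' x + y) := by
    rw [map_add]
    exact congrArg (· + _) (hφ x)
  refine ⟨P, _, f, g, ?_, ?_, ?_, hP, hV⟩
  · rw [injective_iff_map_eq_zero]
    intro x hx
    have h1 : p x = 0 := congrArg Prod.fst hx
    have h2 : -j' x = 0 := congrArg Prod.snd hx
    rw [hj' ⟨x, h1⟩, neg_eq_zero] at h2
    have h3 : (⟨x, h1⟩ : LinearMap.ker p) = 0 := hj (by rw [h2, map_zero])
    exact congrArg Subtype.val h3
  · intro y
    obtain ⟨y, rfl⟩ := Submodule.mkQ_surjective _ y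
    exact ⟨(p 0, y), by rw [hg]; simp⟩
  · rintro ⟨m, y⟩
    obtain ⟨x, rfl⟩ := hp m
    rw [hg, Submodule.mkQ_apply, Submodule.Quotient.mk_eq_zero]
    constructor
    · rintro ⟨n, hn⟩
      rw [← hj'] at hn
      refine ⟨x - n.1, Prod.ext ?_ ?_⟩
      · change p (x - n.1) = p x
        rw [map_sub, n.2, sub_zero]
      · change -j' (x - n.1) = y
        rw [map_sub, hn]
        abel
    · rintro ⟨z, hz⟩
      have h1 : p z = p x := congrArg Prod.fst hz
      have h2 : -j' z = y := congrArg Prod.snd hz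
      refine ⟨⟨x - z, by rw [LinearMap.mem_ker, map_sub, h1, sub_self]⟩, ?_⟩
      rw [← hj', ← h2, map_sub, sub_eq_add_neg]

variable {k : Type w} [CommRing k] [IsArtinianRing k] [Algebra k A]

include k in
/-- Passing from the syzygies to the modules costs one extension. -/
lemma exists_genL_of_syzygy [Module.Finite k A] [IsNoetherianRing A] (T : FGModuleCat.{u} A) :
    ∃ T' : FGModuleCat.{u} A, ∀ (n : ℕ) (U : ObjectProperty (FGModuleCat.{u} A)),
      HasSyzygiesIn U (genL (· = T) n) → ∀ M, U M → genL (· = T') (n + 1) M := by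
  obtain ⟨E, j, hj, hE⟩ := exists_finite_injective (k := k) (A := A) T
  let C := FGModuleCat.of A (E ⧸ LinearMap.range j)
  -- C serves the cosyzygies of T, E the stray injective summands, A the projective covers; none
  -- depends on n or U.
  let T' := FGModuleCat.of A (C × FGModuleCat.of A (E × FGModuleCat.of A A))
  have hC : addL (· = T') C := addL_of_retract (N := T') (addL_of_mem rfl) (.inl A _ _) (.fst A _ _)
    fun _ => rfl
  have hET : addL (· = T') E := addL_of_retract (N := T') (addL_of_mem rfl)
    (.inr A _ _ ∘ₗ .inl A _ _) (.fst A _ _ ∘ₗ .snd A _ _) fun _ => rfl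
  have hA : addL (· = T') (FGModuleCat.of A A) := addL_of_retract (N := T') (addL_of_mem rfl)
    (.inr A _ _ ∘ₗ .inr A _ _) (.snd A _ _ ∘ₗ .snd A _ _) fun _ => rfl
  have hcos : HasCosyzygiesIn E (· = T) (addL (· = T')) := by
    rintro _ rfl
    exact ⟨E, j, hE, addL_of_mem rfl, hj, hC⟩
  refine ⟨T', fun n U hU M hM => ?_⟩
  obtain ⟨P, p, -, hP, hp, hK⟩ := hU M hM
  have hP' : addL (· = T') P := addL_of_addL (fun N hN => hN ▸ hA) _ hP
  match n, hK with
  | 0, hK =>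
    have hK : Subsingleton (LinearMap.ker p) := hK
    exact addL_of_equiv hP' (LinearEquiv.ofBijective p
      ⟨LinearMap.ker_eq_bot.1 (Submodule.subsingleton_iff_eq_bot.1 hK), hp⟩).symm
  | n + 1, hK =>
    obtain ⟨I, l, hI, -, hl, hV⟩ := hcos.genL (addL_of_mem hET) (n + 1) _ hK
    have h := ext_of_embedding_ker p hp hI l hl hP' (genL_mono (fun _ => id) _ _ hV)
    exact addL_of_retract (addL_of_mem h) (.inl A _ _) (.fst A _ _) fun _ => rfl

/-- The modules filtered by alternately `n + 1` modules in `F` and `n` modules in `G`. -/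
def alternating (F G : ObjectProperty (FGModuleCat.{u} A)) :
    ℕ → ObjectProperty (FGModuleCat.{u} A)
  | 0 => F
  | n + 1 => ext F (ext G (alternating F G n))

lemma HasSyzygiesIn.alternating [IsNoetherianRing A] {F G F' G' : ObjectProperty (FGModuleCat.{u} A)}
    (hF : HasSyzygiesIn F F') (hG : HasSyzygiesIn G G') (n : ℕ) :
    HasSyzygiesIn (alternating F G n) (alternating F' G' n) := by
  induction n with
  | zero => exact hF
  | succ n ih => exact hF.ext (hG.ext ih)

lemma alternating_mono {F G F' G' : ObjectProperty (FGModuleCat.{u} A)} (hF : ∀ M, F M → F' M)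
    (hG : ∀ M, G M → G' M) (n : ℕ) : ∀ M, alternating F G n M → alternating F' G' n M := by
  induction n with
  | zero => exact hF
  | succ n ih => exact ext_mono hF (ext_mono hG ih)

/-- The zero factors drop out, leaving n layers in `addL G`. -/
lemma genL_of_alternating {G : ObjectProperty (FGModuleCat.{u} A)} (n : ℕ) :
    ∀ M, alternating (fun M => Subsingleton M) (addL G) n M → genL G n M := by
  induction n with
  | zero => exact fun _ h => h
  | succ n ih =>
    rintro M ⟨N, Q, f, g, hf, hg, hfg, hN, hQ⟩
    have hN : Subsingleton N := hN
    have hg' : Function.Injective g := (injective_iff_map_eq_zero g).2 fun x hx => by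
      obtain ⟨y, rfl⟩ := (hfg x).1 hx
      rw [Subsingleton.elim y 0, map_zero]
    let e := LinearEquiv.ofBijective g ⟨hg', hg⟩
    refine genL_of_retract (n + 1) (N := Q) ?_ e.toLinearMap e.symm.toLinearMap e.symm_apply_apply
    -- `genL G 1` is `addL G` rather than an extension involving `genL G 0`, so the last layer is
    -- separate.
    match n with
    | 0 =>
      obtain ⟨N', Q', f', g', hf', hg', hfg', hN', hQ'⟩ := hQ
      have hQ' : Subsingleton Q' := hQ'
      exact addL_of_equiv hN' (LinearEquiv.ofBijective f'
        ⟨hf', fun x => (hfg' x).1 (Subsingleton.elim _ _)⟩).symm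
    | n + 1 => exact addL_of_mem (ext_mono (fun _ => id) ih _ hQ)

/-- The finitely generated modules of projective dimension less than `d`. -/
def pdLT (d : ℕ) : ObjectProperty (FGModuleCat.{u} A) := fun M => HasProjectiveDimensionLT M.obj d

lemma shortExact_moduleCat {N M Q : FGModuleCat.{u} A} (f : N →ₗ[A] M) (g : M →ₗ[A] Q)
    (hf : Function.Injective f) (hg : Function.Surjective g) (hfg : Function.Exact f g) :
    (ShortComplex.mk (ModuleCat.ofHom f) (ModuleCat.ofHom g) (by
      ext x; exact hfg.apply_apply_eq_zero x)).ShortExact :=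
  { exact := (ShortComplex.ShortExact.moduleCat_exact_iff_function_exact _).2 hfg
    mono_f := (ModuleCat.mono_iff_injective _).2 hf
    epi_g := (ModuleCat.epi_iff_surjective _).2 hg }

lemma pdLT_of_ext (d : ℕ) (M : FGModuleCat.{u} A) (hM : ext (pdLT d) (pdLT d) M) : pdLT d M := by
  obtain ⟨N, Q, f, g, hf, hg, hfg, hN, hQ⟩ := hM
  exact (shortExact_moduleCat f g hf hg hfg).hasProjectiveDimensionLT_X₂ d hN hQ

lemma pdLT_zero (M : FGModuleCat.{u} A) : pdLT 0 M ↔ Subsingleton M := by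
  rw [pdLT, hasProjectiveDimensionLT_zero_iff_isZero, ModuleCat.isZero_iff_subsingleton]

lemma hasSyzygiesIn_pdLT [IsNoetherianRing A] (d : ℕ) :
    HasSyzygiesIn (pdLT (A := A) (d + 1)) (pdLT d) := by
  intro M hM
  obtain ⟨P, p, hP, hP', hp⟩ := exists_projective_cover M
  match d with
  | 0 =>
    have hM : Projective M.obj := projective_iff_hasProjectiveDimensionLT_one.2 hM
    have hM : Module.Projective A M := (IsProjective.iff_projective (R := A) M).2 hM
    obtain ⟨s, hs⟩ := Module.projective_lifting_property p LinearMap.id hp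
    -- The syzygy has to be zero, so M must cover itself; the free cover could have a nonzero
    -- kernel.
    refine ⟨M, LinearMap.id, hM, addL_of_retract hP' s p fun x => DFunLike.congr_fun hs x,
      Function.surjective_id, ?_⟩
    rw [pdLT_zero]
    exact Submodule.subsingleton_iff_eq_bot.2 LinearMap.ker_id
  | d + 1 =>
    have hS := shortExact_moduleCat (N := FGModuleCat.of A (LinearMap.ker p))
      (LinearMap.ker p).subtype p (LinearMap.ker p).subtype_injective hp
      (LinearMap.exact_subtype_ker_map p)
    have hP : Projective P.obj := (IsProjective.iff_projective (R := A) P).1 hP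
    exact ⟨P, p, (IsProjective.iff_projective (R := A) P).2 hP, hP', hp,
      (hS.hasProjectiveDimensionLT_X₃_iff d hP).1 hM⟩

include k in
/-- Modules filtered by `n` modules in `add X` and otherwise by modules of projective dimension
less than `d` are obtained in `d + n` steps. -/
theorem exists_genL_of_alternating [Module.Finite k A] [IsNoetherianRing A] (d : ℕ) :
    ∀ X : FGModuleCat.{u} A, ∃ T : FGModuleCat.{u} A, ∀ (n : ℕ) (M : FGModuleCat.{u} A),
      alternating (pdLT d) (addL (· = X)) n M → genL (· = T) (d + n) M := by
  induction d with
  | zero =>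
    refine fun X => ⟨X, fun n M hM => ?_⟩
    rw [zero_add]
    exact genL_of_alternating n M (alternating_mono (fun M => (pdLT_zero M).1) (fun _ => id) n M hM)
  | succ d ih =>
    intro X
    obtain ⟨P, p, hP, hP', hp⟩ := exists_projective_cover X
    let K := FGModuleCat.of A (LinearMap.ker p)
    -- The summand A absorbs the projectives appearing in `HasSyzygiesIn.addL`. Since X is replaced
    -- by X', the induction is over all X.
    let X' := FGModuleCat.of A (K × FGModuleCat.of A A)
    have hX : HasSyzygiesIn (· = X) (addL (· = X')) := by
      rintro _ rfl
      exact ⟨P, p, hP, hP', hp, addL_of_retract (N := X') (addL_of_mem rfl) (.inl A _ _)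
        (.fst A _ _) fun _ => rfl⟩
    have hX' : HasSyzygiesIn (addL (· = X)) (addL (addL (· = X'))) :=
      hX.addL (addL_of_mem (addL_of_retract (N := X') (addL_of_mem rfl) (.inr A _ _)
        (.snd A _ _) fun _ => rfl))
    obtain ⟨T, hT⟩ := ih X'
    obtain ⟨T', hT'⟩ := exists_genL_of_syzygy (k := k) T
    refine ⟨T', fun n M hM => ?_⟩
    rw [Nat.succ_add]
    refine hT' (d + n) _ ?_ M hM
    intro M hM
    obtain ⟨Q, q, hQ, hQ', hq, hqU⟩ := ((hasSyzygiesIn_pdLT d).alternating hX' n) M hM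
    exact ⟨Q, q, hQ, hQ', hq,
      hT n _ (alternating_mono (fun _ => id) (addL_of_addL fun _ => id) n _ hqU)⟩

end Step

/-! ### Closure properties of classes of filtered modules -/

section Filtration

variable {A : Type u} [Ring A]

/-- A free cover of M kills the radical, so it factors through a power of A/rad A, which is
semisimple; the resulting surjection splits. -/
lemma addL_of_isSemisimpleModule [IsArtinianRing A] (M : FGModuleCat.{u} A)
    (hM : IsSemisimpleModule A M) :
    addL (· = FGModuleCat.of A (A ⧸ Module.jacobson A A)) M := by
  obtain ⟨n, p, hp⟩ := Module.Finite.exists_fin' A M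
  have hs : IsSemisimpleModule A (A ⧸ Module.jacobson A A) :=
    (IsArtinian.isSemisimpleModule_iff_jacobson A _).2 (Module.jacobson_quotient_jacobson A A)
  let q (k : Fin n) : (A ⧸ Module.jacobson A A) →ₗ[A] M :=
    Submodule.liftQ _ (p ∘ₗ .single A (fun _ => A) k) (IsSemisimpleModule.jacobson_le_ker _ _ _ _ _)
  let r : (Fin n → A ⧸ Module.jacobson A A) →ₗ[A] M := ∑ k, q k ∘ₗ .proj k
  have hr : Function.Surjective r := fun m => by
    obtain ⟨x, rfl⟩ := hp m
    refine ⟨fun k => Submodule.Quotient.mk (x k), ?_⟩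
    rw [LinearMap.sum_apply]
    change ∑ k, p (Pi.single k (x k)) = p x
    rw [← map_sum, LinearMap.sum_single_apply]
  obtain ⟨s, hs⟩ := IsSemisimpleModule.lifting_property r hr LinearMap.id
  exact addL_of_retract (addL_pi (B := fun _ : Fin n => FGModuleCat.of A (A ⧸ Module.jacobson A A))
    fun _ => addL_of_mem rfl) s r fun x => DFunLike.congr_fun hs x

/-- `U` is closed under quotients. -/
def QuotientClosed (U : ObjectProperty (FGModuleCat.{u} A)) : Prop :=
  ∀ ⦃M M' : FGModuleCat.{u} A⦄ (f : M →ₗ[A] M'), Function.Surjective f → U M → U M'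

/-- `U` is closed under binary products. -/
def ProdClosed (U : ObjectProperty (FGModuleCat.{u} A)) : Prop :=
  ∀ ⦃M M' : FGModuleCat.{u} A⦄, U M → U M' → U (FGModuleCat.of A (M × M'))

/-- Take the image of N in M'; the remaining quotient of M' is a quotient of Q. -/
lemma QuotientClosed.ext {U V : ObjectProperty (FGModuleCat.{u} A)}
    (hU : QuotientClosed U) (hV : QuotientClosed V) : QuotientClosed (ext U V) := by
  rintro M M' h hh ⟨N, Q, f, g, hf, hg, hfg, hN, hQ⟩
  have hle : LinearMap.ker g ≤ LinearMap.ker ((LinearMap.range (h ∘ₗ f)).mkQ ∘ₗ h) := fun x hx => by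
    obtain ⟨y, rfl⟩ := (hfg x).1 hx
    rw [LinearMap.mem_ker, LinearMap.comp_apply, Submodule.mkQ_apply, Submodule.Quotient.mk_eq_zero]
    exact ⟨y, rfl⟩
  obtain ⟨r, hgr⟩ := exists_apply_comp_eq g hg _ hle
  have hr : Function.Surjective r := .of_comp (g := g) (by
    rw [show r ∘ g = _ from funext hgr]
    exact (Submodule.mkQ_surjective _).comp hh)
  exact ⟨FGModuleCat.of A (LinearMap.range (h ∘ₗ f)), FGModuleCat.of A _,
    (LinearMap.range (h ∘ₗ f)).subtype, (LinearMap.range (h ∘ₗ f)).mkQ,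
    Submodule.subtype_injective _, Submodule.mkQ_surjective _,
    LinearMap.exact_subtype_mkQ _,
    hU (M' := FGModuleCat.of A (LinearMap.range (h ∘ₗ f))) (h ∘ₗ f).rangeRestrict
      (LinearMap.surjective_rangeRestrict _) hN,
    hV (M' := FGModuleCat.of A (M' ⧸ LinearMap.range (h ∘ₗ f))) r hr hQ⟩

lemma ProdClosed.ext {U V : ObjectProperty (FGModuleCat.{u} A)}
    (hU : ProdClosed U) (hV : ProdClosed V) : ProdClosed (ext U V) := by
  rintro M M' ⟨N, Q, f, g, hf, hg, hfg, hN, hQ⟩ ⟨N', Q', f', g', hf', hg', hfg', hN', hQ'⟩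
  refine ⟨_, _, f.prodMap f', g.prodMap g', hf.prodMap hf', hg.prodMap hg', ?_, hU hN hN',
    hV hQ hQ'⟩
  rintro ⟨x, y⟩
  constructor
  · intro h
    obtain ⟨a, ha⟩ := (hfg x).1 (congrArg Prod.fst h)
    obtain ⟨b, hb⟩ := (hfg' y).1 (congrArg Prod.snd h)
    exact ⟨(a, b), Prod.ext ha hb⟩
  · rintro ⟨⟨a, b⟩, h⟩
    rw [← h]
    exact Prod.ext (hfg.apply_apply_eq_zero a) (hfg'.apply_apply_eq_zero b)

lemma QuotientClosed.alternating {F G : ObjectProperty (FGModuleCat.{u} A)}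
    (hF : QuotientClosed F) (hG : QuotientClosed G) (n : ℕ) :
    QuotientClosed (alternating F G n) := by
  induction n with
  | zero => exact hF
  | succ n ih => exact hF.ext (hG.ext ih)

lemma ProdClosed.alternating {F G : ObjectProperty (FGModuleCat.{u} A)}
    (hF : ProdClosed F) (hG : ProdClosed G) (n : ℕ) : ProdClosed (alternating F G n) := by
  induction n with
  | zero => exact hF
  | succ n ih => exact hF.ext (hG.ext ih)

/-- Classes closed under quotients and products that contain the regular module contain every
finitely generated module. -/
lemma mem_of_regular [IsNoetherianRing A] {U : ObjectProperty (FGModuleCat.{u} A)}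
    (hq : QuotientClosed U) (hp : ProdClosed U) (hA : U (FGModuleCat.of A A))
    (M : FGModuleCat.{u} A) : U M := by
  have key : ∀ N : Submodule A M, N.FG → U (FGModuleCat.of A N) := by
    intro N hN
    induction N, hN using Submodule.fg_induction with
    | singleton x =>
      exact hq (M := FGModuleCat.of A A) (M' := FGModuleCat.of A (Submodule.span A {x}))
        (LinearMap.toSpanSingleton A _ ⟨x, Submodule.mem_span_singleton_self x⟩) (by
          rintro ⟨y, hy⟩
          obtain ⟨a, rfl⟩ := Submodule.mem_span_singleton.1 hy
          exact ⟨a, rfl⟩) hA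
    | sup N₁ N₂ _ _ h₁ h₂ =>
      exact hq (M := FGModuleCat.of A (N₁ × N₂)) (M' := FGModuleCat.of A ↥(N₁ ⊔ N₂))
        ((Submodule.inclusion le_sup_left).coprod (Submodule.inclusion le_sup_right)) (by
          rintro ⟨y, hy⟩
          obtain ⟨a, ha, b, hb, rfl⟩ := Submodule.mem_sup.1 hy
          exact ⟨(⟨a, ha⟩, ⟨b, hb⟩), rfl⟩) (hp h₁ h₂)
  exact hq (M := FGModuleCat.of A (⊤ : Submodule A M)) (M' := M) (⊤ : Submodule A M).subtype
    (fun x => ⟨⟨x, trivial⟩, rfl⟩) (key ⊤ (IsNoetherian.noetherian _))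

lemma ext_assoc [IsNoetherianRing A] {U V W : ObjectProperty (FGModuleCat.{u} A)}
    (M : FGModuleCat.{u} A) (hM : ext (ext U V) W M) : ext U (ext V W) M := by
  obtain ⟨N, Q, f, g, hf, hg, hfg, ⟨N₁, N₂, f', g', hf', hg', hfg', h₁, h₂⟩, hQ⟩ := hM
  let R := LinearMap.range (f ∘ₗ f')
  have hle₁ : LinearMap.ker g' ≤ LinearMap.ker (R.mkQ ∘ₗ f) := fun x hx => by
    obtain ⟨y, rfl⟩ := (hfg' x).1 hx
    rw [LinearMap.mem_ker, LinearMap.comp_apply, Submodule.mkQ_apply, Submodule.Quotient.mk_eq_zero]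
    exact ⟨y, rfl⟩
  obtain ⟨a, ha⟩ := exists_apply_comp_eq g' hg' _ hle₁
  have ha (x) : a (g' x) = R.mkQ (f x) := ha x
  have hle₂ : R ≤ LinearMap.ker g := by
    rintro _ ⟨x, rfl⟩
    exact hfg.apply_apply_eq_zero _
  refine ⟨N₁, FGModuleCat.of A (M ⧸ R), f ∘ₗ f', R.mkQ, hf.comp hf', R.mkQ_surjective,
    LinearMap.exact_map_mkQ_range _, h₁, N₂, Q, a, R.liftQ g hle₂, ?_, ?_, ?_, h₂, hQ⟩
  · rw [injective_iff_map_eq_zero]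
    intro x hx
    obtain ⟨x, rfl⟩ := hg' x
    rw [ha, Submodule.mkQ_apply, Submodule.Quotient.mk_eq_zero] at hx
    obtain ⟨y, hy⟩ := hx
    rw [← hf hy]
    exact hfg'.apply_apply_eq_zero y
  · intro y
    obtain ⟨x, rfl⟩ := hg y
    exact ⟨R.mkQ x, rfl⟩
  · intro x
    obtain ⟨x, rfl⟩ := R.mkQ_surjective x
    constructor
    · intro h
      obtain ⟨y, rfl⟩ := (hfg x).1 h
      exact ⟨g' y, ha y⟩
    · rintro ⟨y, hy⟩
      obtain ⟨y, rfl⟩ := hg' y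
      rw [← hy, ha]
      exact hfg.apply_apply_eq_zero y

/-- The trace and radical peel factors off the top, whereas `alternating` adds them at the bottom;
associativity of extensions reconciles the two. -/
lemma alternating_succ_of_ext [IsNoetherianRing A] {F G : ObjectProperty (FGModuleCat.{u} A)}
    (n : ℕ) : ∀ M, ext (ext (alternating F G n) G) F M → alternating F G (n + 1) M := by
  induction n with
  | zero => exact fun M hM => ext_assoc M hM
  | succ n ih =>
    intro M hM
    have h1 := ext_assoc M (ext_mono (ext_assoc) (fun _ => id) M hM)
    have h2 := ext_mono (fun _ => id) (ext_mono (ext_assoc) fun _ => id) M h1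
    have h3 := ext_mono (fun _ => id) (ext_assoc) M h2
    exact ext_mono (fun _ => id) (ext_mono (fun _ => id) ih) M h3

/-- The modules with a finite filtration whose factors belong to `S`. -/
inductive Filtered (S : ObjectProperty (FGModuleCat.{u} A)) : FGModuleCat.{u} A → Prop
  | of_subsingleton {M : FGModuleCat.{u} A} : Subsingleton M → Filtered S M
  | of_exact {N M Y : FGModuleCat.{u} A} (f : N →ₗ[A] M) (g : M →ₗ[A] Y) :
      Function.Surjective g → Function.Injective f → Function.Exact f g → S Y → Filtered S N →
        Filtered S M

variable {S : ObjectProperty (FGModuleCat.{u} A)}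

/-- By simplicity, the quotient induced on the top factor Y is either Y or zero. -/
lemma Filtered.quotientClosed (hS : ∀ M, S M → IsSimpleModule A M) :
    QuotientClosed (Filtered S) := by
  intro M M' h hh hM
  induction hM generalizing M' with
  | of_subsingleton hM => exact .of_subsingleton hh.subsingleton
  | @of_exact N M Y f g hg hf hfg hY _ ih =>
    have := hS Y hY
    let R := LinearMap.range (h ∘ₗ f)
    have hle : LinearMap.ker g ≤ LinearMap.ker (R.mkQ ∘ₗ h) := fun x hx => by
      obtain ⟨y, rfl⟩ := (hfg x).1 hx
      rw [LinearMap.mem_ker, LinearMap.comp_apply, Submodule.mkQ_apply,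
        Submodule.Quotient.mk_eq_zero]
      exact ⟨y, rfl⟩
    obtain ⟨r, hgr⟩ := exists_apply_comp_eq g hg _ hle
    have hr : Function.Surjective r := .of_comp (g := g) (by
      rw [show r ∘ g = _ from funext hgr]
      exact (Submodule.mkQ_surjective _).comp hh)
    rcases LinearMap.injective_or_eq_zero r with hr' | hr'
    · let e' := (LinearEquiv.ofBijective r ⟨hr', hr⟩).symm
      have hN : Filtered S (FGModuleCat.of A R) :=
        ih (h ∘ₗ f).rangeRestrict (LinearMap.surjective_rangeRestrict _)
      refine .of_exact (N := FGModuleCat.of A R) R.subtype (e'.toLinearMap ∘ₗ R.mkQ)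
        (e'.surjective.comp R.mkQ_surjective) R.subtype_injective ?_ hY hN
      rw [LinearMap.exact_iff, LinearEquiv.ker_comp, Submodule.ker_mkQ, Submodule.range_subtype]
    · refine ih (h ∘ₗ f) fun x => ?_
      obtain ⟨y, hy⟩ := hr (R.mkQ x)
      rw [hr', LinearMap.zero_apply] at hy
      exact (Submodule.Quotient.mk_eq_zero R).1 hy.symm

lemma Filtered.of_ext [IsNoetherianRing A] (hS : ∀ M, S M → IsSimpleModule A M)
    (M : FGModuleCat.{u} A) (hM : ext (Filtered S) (Filtered S) M) : Filtered S M := by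
  obtain ⟨N, Q, f, g, hf, hg, hfg, hN, hQ⟩ := hM
  induction hQ generalizing M with
  | of_subsingleton hQ =>
    exact quotientClosed hS f (fun x => (hfg x).1 (Subsingleton.elim _ _)) hN
  | @of_exact Q' Q Y i q hq hi hiq hY _ ih =>
    have hi' : LinearMap.range i = LinearMap.ker q := (LinearMap.exact_iff.1 hiq).symm
    -- K is the preimage in M of the submodule Q' of Q, hence an extension of Q' by N to which the
    -- induction applies.
    let K := LinearMap.ker (q ∘ₗ g)
    have h1 (x) : f x ∈ K := by
      change q (g (f x)) = 0
      rw [hfg.apply_apply_eq_zero, map_zero]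
    have h2 (x : K) : ∃ y, i y = g x := (hiq _).1 x.2
    choose s hs using h2
    let s' : K →ₗ[A] Q' :=
      { toFun := s
        map_add' := fun x y => hi (by simp [hs])
        map_smul' := fun c x => hi (by simp [hs]) }
    refine .of_exact (N := FGModuleCat.of A K) K.subtype (q ∘ₗ g) (hq.comp hg)
      K.subtype_injective (LinearMap.exact_subtype_ker_map _) hY
      (ih (FGModuleCat.of A K) (f.codRestrict K h1) s' ?_ ?_ ?_)
    · exact fun x y hxy => hf (congrArg Subtype.val hxy)
    · intro y
      obtain ⟨x, hx⟩ := hg (i y)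
      refine ⟨⟨x, ?_⟩, hi ?_⟩
      · change q (g x) = 0
        rw [hx, hiq.apply_apply_eq_zero]
      · exact (hs _).trans hx
    · intro x
      constructor
      · intro h
        have h3 : g x.1 = 0 := by
          rw [← hs x, show s x = 0 from h, map_zero]
        obtain ⟨y, hy⟩ := (hfg _).1 h3
        exact ⟨y, Subtype.ext hy⟩
      · rintro ⟨y, hy⟩
        rw [← hy]
        refine hi ((hs _).trans ?_)
        rw [map_zero]
        exact hfg.apply_apply_eq_zero y

lemma Filtered.prodClosed [IsNoetherianRing A] (hS : ∀ M, S M → IsSimpleModule A M) :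
    ProdClosed (Filtered S) := fun M M' hM hM' =>
  of_ext hS _ ⟨M, M', .inl A M M', .snd A M M', LinearMap.inl_injective, LinearMap.snd_surjective,
    Function.Exact.inl_snd, hM, hM'⟩

lemma Filtered.pdLT {d : ℕ} (hS : ∀ M, S M → pdLT d M) (M : FGModuleCat.{u} A)
    (hM : Filtered S M) : pdLT d M := by
  induction hM with
  | of_subsingleton hM =>
    have h := (pdLT_zero _).2 hM
    have : HasProjectiveDimensionLT _ 0 := h
    exact hasProjectiveDimensionLT_of_ge _ 0 d (Nat.zero_le d)
  | of_exact f g hg hf hfg hY _ ih => exact pdLT_of_ext d _ ⟨_, _, f, g, hf, hg, hfg, ih, hS _ hY⟩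

end Filtration

lemma isSemisimpleModule_prod {A M M' : Type*} [Ring A] [AddCommGroup M] [Module A M]
    [AddCommGroup M'] [Module A M'] [IsSemisimpleModule A M] [IsSemisimpleModule A M'] :
    IsSemisimpleModule A (M × M') := by
  have h := IsSemisimpleModule.sup (p := LinearMap.range (LinearMap.inl A M M'))
    (q := LinearMap.range (LinearMap.inr A M M'))
    (IsSemisimpleModule.congr (LinearEquiv.ofInjective _ LinearMap.inl_injective).symm)
    (IsSemisimpleModule.congr (LinearEquiv.ofInjective _ LinearMap.inr_injective).symm)
  rw [LinearMap.sup_range_inl_inr] at h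
  exact IsSemisimpleModule.congr Submodule.topEquiv.symm

/-! ### The trace of the torsion class and the resulting filtration -/

section Torsion

variable {A : Type u} [Ring A] {S : ObjectProperty (FGModuleCat.{u} A)}

lemma filtered_of_simple_quotients [IsNoetherianRing A] [IsArtinianRing A]
    (hS : ∀ M, S M → IsSimpleModule A M) (Q : FGModuleCat.{u} A)
    (h : ∀ (U : Submodule A Q) (X : FGModuleCat.{u} A) (g : U →ₗ[A] X), Function.Surjective g →
      IsSimpleModule A X → ∃ Y, S Y ∧ Nonempty (X ≅ Y)) : Filtered S Q := by
  have key : ∀ U : Submodule A Q, Filtered S (FGModuleCat.of A U) := by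
    intro U
    induction U using WellFoundedLT.induction with
    | ind U ih =>
      rcases subsingleton_or_nontrivial U with hU | hU
      · exact .of_subsingleton hU
      · obtain ⟨V, hV⟩ := IsCoatomic.exists_coatom (Submodule A U)
        have hX : IsSimpleModule A (U ⧸ V) := isSimpleModule_iff_isCoatom.2 hV
        obtain ⟨Y, hY, ⟨e⟩⟩ := h U (FGModuleCat.of A (U ⧸ V)) V.mkQ V.mkQ_surjective hX
        let e := FGModuleCat.isoToLinearEquiv e
        have hle : V.map U.subtype ≤ U := Submodule.map_subtype_le _ _
        have hlt : V.map U.subtype < U := lt_of_le_of_ne hle fun h' => hV.1 (by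
          rw [eq_top_iff]
          rintro ⟨x, hx⟩ -
          rw [← h'] at hx
          obtain ⟨y, hy, rfl⟩ := hx
          exact hy)
        refine .of_exact (N := FGModuleCat.of A (V.map U.subtype)) (Submodule.inclusion hle)
          (e.toLinearMap ∘ₗ V.mkQ) (e.surjective.comp V.mkQ_surjective)
          (Submodule.inclusion_injective hle) ?_ hY (ih _ hlt)
        refine LinearMap.exact_iff.2 ?_
        refine (LinearEquiv.ker_comp e V.mkQ).trans ?_
        rw [Submodule.ker_mkQ, Submodule.range_inclusion,
          Submodule.comap_map_eq_of_injective U.subtype_injective]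
  exact Filtered.quotientClosed hS (M := FGModuleCat.of A (⊤ : Submodule A Q))
    (⊤ : Submodule A Q).subtype (fun x => ⟨⟨x, trivial⟩, rfl⟩) (key ⊤)

/-- A homomorphism onto a simple module outside `S` does not vanish on the trace of the torsion
class. -/
lemma exists_apply_ne_zero_of_simple [IsNoetherianRing A] [IsArtinianRing A] (U X : FGModuleCat.{u} A)
    (g : U →ₗ[A] X) (hg : Function.Surjective g) (hX : IsSimpleModule A X)
    (hXS : ∀ Y, S Y → IsEmpty (X ≅ Y)) :
    ∃ W : Submodule A U, torsionClass S (FGModuleCat.of A W) ∧ ∃ x ∈ W, g x ≠ 0 := by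
  have := IsSimpleModule.nontrivial A X
  -- For a minimal W not killed by g, every proper submodule of W is killed. Hence ker(g|W) is the
  -- only maximal submodule, and W has top X.
  obtain ⟨W, hW, hmin⟩ := IsArtinian.set_has_minimal {W : Submodule A U | ¬ W ≤ LinearMap.ker g}
    ⟨⊤, fun h => by
      obtain ⟨y, hy⟩ := exists_ne (0 : X)
      obtain ⟨x, rfl⟩ := hg y
      exact hy (h trivial)⟩
  obtain ⟨x, hxW, hx⟩ := SetLike.not_le_iff_exists.1 hW
  let φ : W →ₗ[A] X := g ∘ₗ W.subtype
  have hφ : Function.Surjective φ := (LinearMap.surjective_or_eq_zero φ).resolve_right fun h =>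
    hx (DFunLike.congr_fun h (⟨x, hxW⟩ : W))
  have hker : ∀ Z : Submodule A W, Z ≠ ⊤ → Z ≤ LinearMap.ker φ := by
    intro Z hZ
    by_contra hZφ
    refine hmin (Z.map W.subtype) (fun h => hZφ fun z hz => h ⟨z, hz, rfl⟩) ?_
    refine lt_of_le_of_ne (Submodule.map_subtype_le _ _) fun h => hZ ?_
    rw [eq_top_iff]
    rintro ⟨y, hy⟩ -
    rw [← h] at hy
    obtain ⟨z, hz, rfl⟩ := hy
    exact hz
  let e := φ.quotKerEquivOfSurjective hφ
  have hcoatom : IsCoatom (LinearMap.ker φ) :=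
    isSimpleModule_iff_isCoatom.1 (IsSimpleModule.congr e)
  have hjac : Module.jacobson A W = LinearMap.ker φ :=
    le_antisymm (sInf_le hcoatom)
      (le_sInf fun Z hZ => ((hZ.le_iff.1 (hker Z hZ.1)).resolve_left hcoatom.1).le)
  let e' : (W ⧸ Module.jacobson A W) ≃ₗ[A] X := (Submodule.quotEquivOfEq _ _ hjac).trans e
  refine ⟨W, add_of_addL (addL_of_mem ⟨IsSimpleModule.congr e', fun Y hY => ⟨fun i => ?_⟩⟩),
    x, hxW, hx⟩
  exact (hXS Y hY).false (e'.toFGModuleCatIso.symm ≪≫ i)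

/-- Suppose a submodule U of the quotient mapped onto a simple X outside S. The preimage of U in M
would contain a torsion module not killed by the map to X; but that module lies in the trace, so it
vanishes in U. -/
lemma filtered_quotient_trace [IsNoetherianRing A] [IsArtinianRing A]
    (hS : ∀ M, S M → IsSimpleModule A M) (M : FGModuleCat.{u} A) :
    Filtered S (FGModuleCat.of A (M ⧸ trace (torsionClass S) M.obj)) := by
  refine filtered_of_simple_quotients hS _ fun U X g hg hX => ?_
  by_contra! hXS
  let t : Submodule A M := trace (torsionClass S) M.obj
  let q : U.comap t.mkQ →ₗ[A] U := t.mkQ.restrict fun _ h => h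
  have hq : Function.Surjective q := by
    rintro ⟨y, hy⟩
    obtain ⟨x, rfl⟩ := t.mkQ_surjective y
    exact ⟨⟨x, hy⟩, rfl⟩
  obtain ⟨W, hW, x, hxW, hx⟩ := exists_apply_ne_zero_of_simple (S := S)
    (FGModuleCat.of A (U.comap t.mkQ)) X (g ∘ₗ q) (hg.comp hq) hX hXS
  have hxt : x.1 ∈ t := by
    let f : W →ₗ[A] M := (U.comap t.mkQ).subtype ∘ₗ W.subtype
    have h1 : LinearMap.range f ≤ t :=
      le_iSup_of_le (FGModuleCat.of A W) (le_iSup_of_le hW (le_iSup_of_le f le_rfl))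
    exact h1 ⟨⟨x, hxW⟩, rfl⟩
  refine hx ?_
  have : q x = 0 := Subtype.ext ((Submodule.Quotient.mk_eq_zero t).2 hxt)
  rw [LinearMap.comp_apply, this, map_zero]

/-- Each layer is read off M ⊇ t(M) ⊇ rad t(M): the first quotient is filtered by S, the second is
semisimple, and the induction continues with rad t(M). -/
lemma alternating_of_isZero [IsNoetherianRing A] [IsArtinianRing A]
    (hS : ∀ M, S M → IsSimpleModule A M) (n : ℕ) :
    ∀ (M : ModuleCat.{u} A) [Module.Finite A M],
      IsZero (traceObj (torsionClass S) ((radObj ∘ traceObj (torsionClass S))^[n] M)) →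
        alternating (Filtered S) (fun M => IsSemisimpleModule A M) n (FGModuleCat.of A M) := by
  induction n with
  | zero =>
    intro M _ hM
    have hM : Subsingleton (trace (torsionClass S) M) :=
      (ModuleCat.isZero_iff_subsingleton).1 hM
    exact Filtered.of_ext hS _ ⟨FGModuleCat.of A (trace (torsionClass S) M), FGModuleCat.of A _,
      (trace (torsionClass S) M).subtype, (trace (torsionClass S) M).mkQ,
      Submodule.subtype_injective _, Submodule.mkQ_surjective _, LinearMap.exact_subtype_mkQ _,
      .of_subsingleton hM, filtered_quotient_trace hS (FGModuleCat.of A M)⟩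
  | succ n ih =>
    intro M _ hM
    rw [Function.iterate_succ_apply] at hM
    let t := trace (torsionClass S) M
    let r := Module.jacobson A t
    have hr := ih (ModuleCat.of A r) hM
    refine alternating_succ_of_ext n _ ⟨FGModuleCat.of A t, FGModuleCat.of A (M ⧸ t), t.subtype,
      t.mkQ, t.subtype_injective, t.mkQ_surjective, LinearMap.exact_subtype_mkQ _, ?_,
      filtered_quotient_trace hS (FGModuleCat.of A M)⟩
    exact ⟨FGModuleCat.of A r, FGModuleCat.of A (t ⧸ r), r.subtype, r.mkQ, r.subtype_injective,
      r.mkQ_surjective, LinearMap.exact_subtype_mkQ _, hr,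
      (IsArtinian.isSemisimpleModule_iff_jacobson A _).2 (Module.jacobson_quotient_jacobson A t)⟩

end Torsion

/-! ### Numerical invariants and the final bound -/

section Bounds

variable {A : Type u} [Ring A]

lemma coe_enat_natCast (n : ℕ) : (((n : ℕ∞) : ℝ≥0∞) : EReal) = ((n : ℝ) : EReal) := by
  rw [ENat.toENNReal_coe, ← ENNReal.coe_natCast, EReal.coe_nnreal_eq_coe_real, NNReal.coe_natCast]

lemma le_pd {M : ModuleCat.{v} A} {n : ℕ} (h : ¬ HasProjectiveDimensionLT M n) :
    (((n : ℕ) : ℝ) : EReal) ≤ pd M := by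
  rw [← projectiveDimension_ge_iff] at h
  unfold pd
  generalize projectiveDimension M = x at h
  induction x with
  | bot => exact absurd h (by simp)
  | coe x =>
    have h : (n : ℕ∞) ≤ x := by exact_mod_cast h
    have h2 : ((n : ℕ∞) : ℝ≥0∞) ≤ (x : ℝ≥0∞) := by exact_mod_cast h
    have h3 := EReal.coe_ennreal_le_coe_ennreal_iff.2 h2
    rwa [coe_enat_natCast] at h3

/-- Take the least d that works: minimality yields a member of projective dimension at least d - 1.
For the empty class d = 0, which matches the convention -1. -/
lemma pdClass_eq_top_or (S : ObjectProperty (FGModuleCat.{u} A)) :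
    pdClass S = ⊤ ∨
      ∃ d : ℕ, (∀ M, S M → pdLT d M) ∧ (((d : ℝ) - 1 : ℝ) : EReal) ≤ pdClass S := by
  by_cases hne : ∃ M, S M
  swap
  · right
    refine ⟨0, fun M hM => absurd ⟨M, hM⟩ hne, ?_⟩
    rw [pdClass, if_neg hne]
    simp
  have hle : ∀ M, S M → pd M.obj ≤ pdClass S := fun M hM => by
    rw [pdClass, if_pos hne]
    exact le_iSup₂_of_le M hM le_rfl
  by_cases hd : ∃ d : ℕ, ∀ M, S M → pdLT d M
  · right
    classical
    refine ⟨Nat.find hd, Nat.find_spec hd, ?_⟩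
    obtain ⟨M, hM⟩ := hne
    rcases h : Nat.find hd with _ | e
    · refine le_trans ?_ (hle M hM)
      unfold pd
      generalize projectiveDimension M.obj = x
      induction x with
      | bot => simp
      | coe x => exact le_trans (by simp) (EReal.coe_ennreal_nonneg _)
    · have := Nat.find_min hd (m := e) (by lia)
      push Not at this
      obtain ⟨N, hN, hN'⟩ := this
      refine le_trans ?_ ((le_pd hN').trans (hle N hN))
      simp
  · left
    push Not at hd
    rw [EReal.eq_top_iff_forall_lt]
    intro y
    obtain ⟨n, hn⟩ := exists_nat_gt y
    obtain ⟨N, hN, hN'⟩ := hd n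
    exact lt_of_lt_of_le (by exact_mod_cast hn) ((le_pd hN').trans (hle N hN))

lemma layerLength_eq_top_or (α β : ModuleCat.{v} A → ModuleCat.{v} A) (M : ModuleCat.{v} A) :
    layerLength α β M = ⊤ ∨ ∃ n : ℕ, layerLength α β M = n ∧ IsZero (α (β^[n] M)) := by
  by_cases h : ∃ n, IsZero (α (β^[n] M))
  · right
    classical
    refine ⟨Nat.find h, le_antisymm (iInf₂_le (Nat.find h) (Nat.find_spec h)) ?_, Nat.find_spec h⟩
    exact le_iInf₂ fun i hi => by exact_mod_cast Nat.find_min' h hi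
  · left
    push Not at h
    simp [layerLength, h]

end Bounds

theorem extDim_le_pdClass_add_radicalLayerLength (k : Type w) [CommRing k] [IsArtinianRing k]
    (Λ : Type u) [Ring Λ] [Nontrivial Λ] [Algebra k Λ] [Module.Finite k Λ]
    (S : ObjectProperty (FGModuleCat.{u} Λᵐᵒᵖ))
    (hS : ∀ M, S M → IsSimpleModule Λᵐᵒᵖ M ∧ projectiveDimension M.obj ≠ ⊤) :
    ((extDim (FGModuleCat.{u} Λᵐᵒᵖ) : ℝ≥0∞) : EReal) ≤
      pdClass S +
        ((radicalLayerLength (traceObj (torsionClass S))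
          (ModuleCat.of Λᵐᵒᵖ Λ) : ℝ≥0∞) : EReal) := by
  have hS' : ∀ M, S M → IsSimpleModule Λᵐᵒᵖ M := fun M hM => (hS M hM).1
  have hfin : Module.Finite k Λᵐᵒᵖ := Module.Finite.equiv (MulOpposite.opLinearEquiv k : Λ ≃ₗ[k] _)
  have : IsArtinianRing Λᵐᵒᵖ := IsArtinianRing.of_finite k Λᵐᵒᵖ
  have : IsNoetherianRing Λᵐᵒᵖ := inferInstance
  let e : Λ ≃ₗ[Λᵐᵒᵖ] Λᵐᵒᵖ :=
    { MulOpposite.opAddEquiv with map_smul' := fun a x => rfl }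
  have : Module.Finite Λᵐᵒᵖ Λ := Module.Finite.equiv e.symm
  rcases pdClass_eq_top_or S with hp | ⟨d, hd, hdp⟩
  · rw [hp, EReal.top_add_of_ne_bot (EReal.coe_ennreal_ne_bot _)]
    exact le_top
  rcases layerLength_eq_top_or (traceObj (torsionClass S)) (radObj ∘ traceObj (torsionClass S))
    (ModuleCat.of Λᵐᵒᵖ Λ) with hl | ⟨n, hl, hn⟩
  · rw [radicalLayerLength, hl, ENat.toENNReal_top, EReal.coe_ennreal_top,
      EReal.add_top_of_ne_bot (ne_bot_of_le_ne_bot (EReal.coe_ne_bot _) hdp)]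
    exact le_top
  have hΛ := alternating_of_isZero hS' n (ModuleCat.of Λᵐᵒᵖ Λ) hn
  have hsq : QuotientClosed (fun M : FGModuleCat.{u} Λᵐᵒᵖ => IsSemisimpleModule Λᵐᵒᵖ M) :=
    fun M M' f hf (_ : IsSemisimpleModule Λᵐᵒᵖ M) =>
      IsSemisimpleModule.congr (f.quotKerEquivOfSurjective hf).symm
  have hsp : ProdClosed (fun M : FGModuleCat.{u} Λᵐᵒᵖ => IsSemisimpleModule Λᵐᵒᵖ M) :=
    fun M M' (_ : IsSemisimpleModule Λᵐᵒᵖ M) (_ : IsSemisimpleModule Λᵐᵒᵖ M') =>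
      isSemisimpleModule_prod
  -- Closure under quotients also carries the filtration along e, from Λ as a right module to the
  -- regular module of the opposite ring.
  have hq := (Filtered.quotientClosed hS').alternating hsq n
  have hall := mem_of_regular hq ((Filtered.prodClosed hS').alternating hsp n)
    (hq (M' := FGModuleCat.of Λᵐᵒᵖ Λᵐᵒᵖ) e.toLinearMap e.surjective hΛ)
  obtain ⟨T, hT⟩ := exists_genL_of_alternating (k := k) d
    (FGModuleCat.of Λᵐᵒᵖ (Λᵐᵒᵖ ⧸ Module.jacobson Λᵐᵒᵖ Λᵐᵒᵖ))
  have hT' : ∀ M, genL (· = T) (d + n) M := fun M =>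
    hT n M (alternating_mono (Filtered.pdLT hd) addL_of_isSemisimpleModule n M (hall M))
  -- Dimension m means m + 1 layers, so at least one is required; zero layers would force Λ = 0.
  obtain ⟨m, hm⟩ : ∃ m, d + n = m + 1 := by
    refine Nat.exists_eq_succ_of_ne_zero fun h0 => ?_
    have h1 := hT' (FGModuleCat.of Λᵐᵒᵖ Λᵐᵒᵖ)
    rw [h0] at h1
    have h1 : Subsingleton Λᵐᵒᵖ := h1
    exact not_subsingleton Λᵐᵒᵖ h1
  have hext : extDim (FGModuleCat.{u} Λᵐᵒᵖ) ≤ m := by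
    refine iInf₂_le m ⟨T, ?_⟩
    ext M
    refine ⟨fun _ => trivial, fun _ => gen_of_genL _ M (genL_mono ?_ _ M (hm ▸ hT' M))⟩
    rintro _ rfl
    exact addL_of_mem (by simp)
  have h1 : ((extDim (FGModuleCat.{u} Λᵐᵒᵖ) : ℝ≥0∞) : EReal) ≤ (((m : ℝ)) : EReal) := by
    refine (EReal.coe_ennreal_le_coe_ennreal_iff.2 (ENat.toENNReal_le.2 hext)).trans (le_of_eq ?_)
    exact coe_enat_natCast m
  refine h1.trans ?_
  rw [radicalLayerLength, hl]
  rw [coe_enat_natCast]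
  -- Here m = (d - 1) + n, and d - 1 is at most pd S.
  refine le_trans (le_of_eq ?_) (add_le_add_left hdp _)
  rw [← EReal.coe_add]
  congr 1
  have : (d : ℝ) + n = m + 1 := by exact_mod_cast hm
  linarith

end ExtDim

/-- For a nonzero artin algebra `Λ` over `k` and a class `S` of simple right `Λ`-modules of finite
projective dimension, `dim mod Λ ≤ pd S + ℓℓ^{t_S}(Λ)`. Right `Λ`-modules are `Λᵐᵒᵖ`-modules. -/
theorem theorem3p19 (k : Type w) [CommRing k] [IsArtinianRing k]
    (Λ : Type u) [Ring Λ] [Nontrivial Λ] [Algebra k Λ] [Module.Finite k Λ]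
    (S : ObjectProperty (FGModuleCat.{u} Λᵐᵒᵖ))
    (hS : ∀ M, S M → IsSimpleModule Λᵐᵒᵖ M ∧ projectiveDimension M.obj ≠ ⊤) :
    ((ExtDim.extDim (FGModuleCat.{u} Λᵐᵒᵖ) : ℝ≥0∞) : EReal) ≤
      ExtDim.pdClass S +
        ((ExtDim.radicalLayerLength (ExtDim.traceObj (ExtDim.torsionClass S))
          (ModuleCat.of Λᵐᵒᵖ Λ) : ℝ≥0∞) : EReal) :=
  ExtDim.extDim_le_pdClass_add_radicalLayerLength k Λ S hS
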